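/- Let $X$ be a first-countable compact Hausdorff space, let $\gamma=(\gamma_1,\dots,\gamma_N)$ be continuous maps $X\to X$ (repetitions allowed), and let $\mathbb X\subseteq X$. For a set $S$ put $\gamma(S)=\bigcup_k\gamma_k(S)$, and for a finite index sequence $\boldsymbol k=(k_n,\dots,k_1)$ put $\gamma_{\boldsymbol k}=\gamma_{k_n}\circ\cdots\circ\gamma_{k_1}$ (the identity if $\boldsymbol k$ is empty). Assume: 1. $\mathbb X$ is dense in $X$ and completely invariant, i.e. $\gamma_k(\mathbb X)\subseteq\mathbb X$ and $\gamma_k^{-1}(\mathbb X)\subseteq\mathbb X$ for all $k$; the sets $\gamma_1(\mathbb X),\dots,\gamma_N(\mathbb X)$ are pairwise disjoint; each $\gamma_k|_{\mathbb X}$ is injective; 2. every $\gamma_k$ is an embedding; 3. there is a dense open set $U\subseteq X$ such that $\gamma_1(U),\dots,\gamma_N(U)$ are pairwise disjoint, open in $X$ and contained in $U$, and $\mathbb X\subseteq U$; moreover $\mathbb X$ is comeager in $X$; 4. $\gamma$ is essentially free: $\{x\in X:\gamma_{\boldsymbol k}(x)=\gamma_{\boldsymbol l}(x)\}$ is nowhere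 dense for all distinct finite index sequences $\boldsymbol k\ne\boldsymbol l$ (possibly of different lengths); 5. $\gamma^n(X)$ is clopen in $X$ for all $n$; 6. there is a continuous map $\sigma:\gamma(X)\to X$ with $\sigma\circ\gamma_k=\mathrm{id}_X$ for all $k$. Notation. Let $G=\{(\gamma_k(y),y): y\in X,\ 1\le k\le N\}$, let $M_{\mathbb X}$ be the algebra of bounded operators on $\ell^2(\mathbb X)$ with standard basis $(\mathbf e_x)_{x\in\mathbb X}$, and let $\upsilon_k$ ($k\in\mathbb Z$) be the shift $\mathbf e_n\mapsto \mathbf e_{k+n}$ on $\ell^2(\mathbb Z)$; $C^*(\mathbb Z)$ is the C*-algebra generated by the $\upsilon_k$. Define $\rho_A(a)\mathbf e_x=a(x)\mathbf e_x$ for $a\in C(X)$ and $\rho_E(f)\mathbf e_y=\sum_k f(\gamma_k(y),y)\,\mathbf e_{\gamma_k(y)}$ for $f\in C(G)$, and put $\hat\rho_A(a)=\rho_A(a)\otimes\upsilon_0$, $\hat\rho_E(f)=\rho_E(f)\otimes\upsilon_1$. Let $C^*(\hat\rho)$ be the C*-subalgebra of $M_{\mathbb X}\otimes C^*(\mathbb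 Z)$ generated by $\hat\rho_A(C(X))\cup\hat\rho_E(C(G))$. A $\gamma$-chain of length $n$ is a sequence $(x_n,\dots,x_0)$ in $X$ such that each $x_{i+1}$ equals $\gamma_k(x_i)$ for some $k$; for $\boldsymbol k$ of length $n$ let $\boldsymbol\gamma_{\boldsymbol k}(x)=(\gamma_{k_n\cdots k_1}(x),\dots,\gamma_{k_1}(x),x)$. Let $X_{m,n}$ be the space of pairs of $\gamma$-chains of lengths $m$ and $n$ with the same last entry $x_0$. For $f\in C(X_{m,n})$ let $\rho_{m,n}(f)\in M_{\mathbb X}$ be the operator with $\rho_{m,n}(f)\mathbf e_{\gamma_{\boldsymbol k}(x)}=\sum_{\boldsymbol j}f(\boldsymbol\gamma_{\boldsymbol j}(x),\boldsymbol\gamma_{\boldsymbol k}(x))\,\mathbf e_{\gamma_{\boldsymbol j}(x)}$ for $x\in\mathbb X$ and $\boldsymbol k$ of length $n$ (the sum is over all $\boldsymbol j$ of length $m$), and $\rho_{m,n}(f)\mathbf e_y=0$ for $y\in\mathbb X\setminus\gamma^n(\mathbb X)$. For $k\in\mathbb Z$ let $B_k$ be the closed linear span of the ranges of all $\rho_{m,n}$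 with $m-n=k$, let $D_k$ be the set of diagonal matrices in $B_k$, and let $\hat D=\overline{\bigoplus_{k\in\mathbb Z}D_k\otimes\upsilon_k}$. A Cartan subalgebra of a C*-algebra $B$ is an abelian C*-subalgebra $A$ that contains an approximate unit of $B$, is maximal abelian, is regular (the set $\{b\in B: bAb^*\subseteq A,\ b^*Ab\subseteq A\}$ generates $B$ as a C*-algebra), and admits a faithful conditional expectation of $B$ onto $A$. Theorem. Under these assumptions the following are equivalent: (1) $\gamma$ satisfies the graph separation condition: $\gamma_j(x)\neq\gamma_k(x)$ for all $j\neq k$ and all $x\in X$; (2) $\hat D$ is a Cartan subalgebra of $C^*(\hat\rho)$. -/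

import Mathlib

open Set Topology
open scoped ENNReal

noncomputable section

/-! ### Iterated function systems -/

namespace IFS

variable {X : Type*} [TopologicalSpace X] {N : ℕ}

/-- The graph `{(x, y) | x = γ_k(y) for some k}` of an iterated function system. -/
def graph (γ : Fin N → C(X, X)) : Set (X × X) := {p | ∃ k, p.1 = γ k p.2}

/-- `γ(S) = γ_1(S) ∪ ⋯ ∪ γ_N(S)`. -/
def image (γ : Fin N → C(X, X)) (S : Set X) : Set X := ⋃ k, γ k '' S

/-- For an index sequence `k = (k_n, …, k_1)` (the letter `k_{i+1}` is `k i`), the chain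
`(γ_{k_n ⋯ k_1}(x), …, γ_{k_1}(x), x)`; its entry number `i` is `γ_{k_i ⋯ k_1}(x)`. -/
def orbit (γ : Fin N → C(X, X)) {n : ℕ} (k : Fin n → Fin N) (x : X) : Fin (n + 1) → X :=
  Fin.induction x (fun i y => γ (k i) y)

/-- The composition `γ_{k_n} ∘ ⋯ ∘ γ_{k_1}`; it is the identity for the empty sequence. -/
def wordMap (γ : Fin N → C(X, X)) {n : ℕ} (k : Fin n → Fin N) (x : X) : X :=
  orbit γ k x (Fin.last n)

/-- For all distinct indices `j ≠ k` and all points `x`, `γ_j(x) ≠ γ_k(x)`. -/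
def GraphSeparation (γ : Fin N → C(X, X)) : Prop :=
  ∀ j k, j ≠ k → ∀ x, γ j x ≠ γ k x

/-- Essential freeness: `{x | γ_k(x) = γ_l(x)}` is nowhere dense for all distinct finite sequences
of indices `k`, `l`, possibly of different lengths. -/
def EssentiallyFree (γ : Fin N → C(X, X)) : Prop :=
  ∀ k l : (n : ℕ) × (Fin n → Fin N), k ≠ l →
    IsNowhereDense {x : X | wordMap γ k.2 x = wordMap γ l.2 x}

/-- `S` contains all images `γ_k(S)` and all preimages `γ_k⁻¹(S)`. -/
def CompletelyInvariant (γ : Fin N → C(X, X)) (S : Set X) : Prop :=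
  ∀ k, γ k '' S ⊆ S ∧ γ k ⁻¹' S ⊆ S

/-- The conditions under which the representation on `ℓ²(Y)` is defined. -/
structure Admissible (γ : Fin N → C(X, X)) (Y : Set X) : Prop where
  dense : Dense Y
  invariant : CompletelyInvariant γ Y
  disjoint : ∀ j k, j ≠ k → Disjoint (γ j '' Y) (γ k '' Y)
  injOn : ∀ k, InjOn (γ k) Y

/-- The open set `U` witnesses the open set condition. -/
structure OpenSetCondition (γ : Fin N → C(X, X)) (U : Set X) : Prop where
  isOpen : IsOpen U
  dense : Dense U
  isOpen_image : ∀ k, IsOpen (γ k '' U)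
  disjoint : ∀ j k, j ≠ k → Disjoint (γ j '' U) (γ k '' U)
  subset : ∀ k, γ k '' U ⊆ U

/-- The space of chains `(x_n, …, x_0)` of length `n`, that is, each `x_{i+1}` is `γ_k(x_i)` for
some `k`, as a subspace of a power of `X`. -/
def Chain (γ : Fin N → C(X, X)) (n : ℕ) : Set (Fin (n + 1) → X) :=
  {c | ∀ i : Fin n, ∃ k, c i.succ = γ k (c i.castSucc)}

/-- The space of bichains of length `(m, n)`: pairs of chains of lengths `m` and `n` with the same
initial point, as a subspace of the product. -/
def Bichain (γ : Fin N → C(X, X)) (m n : ℕ) : Set (Chain γ m × Chain γ n) :=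
  {z | z.1.1 0 = z.2.1 0}

theorem continuous_orbit (γ : Fin N → C(X, X)) {n : ℕ} (k : Fin n → Fin N) :
    Continuous (orbit γ k) := by
  refine continuous_pi fun i => ?_
  induction i using Fin.induction with
  | zero => simpa [orbit] using continuous_id'
  | succ i ih => simpa [orbit] using! (γ (k i)).continuous.comp ih

theorem orbit_mem_chain (γ : Fin N → C(X, X)) {n : ℕ} (k : Fin n → Fin N) (x : X) :
    orbit γ k x ∈ Chain γ n := fun i => ⟨k i, by simp [orbit]⟩

/-- `x ↦ (chain of x along j, chain of x along k)`. -/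
def biorbit (γ : Fin N → C(X, X)) {m n : ℕ} (j : Fin m → Fin N) (k : Fin n → Fin N) :
    C(X, Bichain γ m n) where
  toFun x := ⟨(⟨orbit γ j x, orbit_mem_chain γ j x⟩, ⟨orbit γ k x, orbit_mem_chain γ k x⟩), rfl⟩
  continuous_toFun :=
    (((continuous_orbit γ j).subtype_mk _).prodMk ((continuous_orbit γ k).subtype_mk _)).subtype_mk _

/-- `y ↦ (γ_k(y), y)`. -/
def graphMap (γ : Fin N → C(X, X)) (k : Fin N) : C(X, graph γ) where
  toFun y := ⟨(γ k y, y), k, rfl⟩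
  continuous_toFun := ((γ k).continuous.prodMk continuous_id).subtype_mk _

theorem Admissible.orbit_mem {γ : Fin N → C(X, X)} {Y : Set X} (h : Admissible γ Y) {n : ℕ}
    (k : Fin n → Fin N) {x : X} (hx : x ∈ Y) (i : Fin (n + 1)) : orbit γ k x i ∈ Y := by
  induction i using Fin.induction with
  | zero => simpa [orbit] using hx
  | succ i ih => exact (h.invariant (k i)).1 ⟨_, ih, by simp [orbit]⟩

theorem Admissible.orbit_inj {γ : Fin N → C(X, X)} {Y : Set X} (h : Admissible γ Y) {n : ℕ}
    (k : Fin n → Fin N) {x y : X} (hx : x ∈ Y) (hy : y ∈ Y) (i : Fin (n + 1))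
    (e : orbit γ k x i = orbit γ k y i) : x = y := by
  induction i using Fin.induction with
  | zero => simpa [orbit] using e
  | succ i ih =>
    refine ih (h.injOn (k i) (h.orbit_mem k hx _) (h.orbit_mem k hy _) ?_)
    simpa [orbit] using e

/-- The restriction of `γ_{k_n} ∘ ⋯ ∘ γ_{k_1}` to `Y`. -/
def Admissible.word {γ : Fin N → C(X, X)} {Y : Set X} (h : Admissible γ Y) {n : ℕ}
    (k : Fin n → Fin N) (x : Y) : Y := ⟨wordMap γ k x, h.orbit_mem k x.2 _⟩

theorem Admissible.word_injective {γ : Fin N → C(X, X)} {Y : Set X} (h : Admissible γ Y) {n : ℕ}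
    (k : Fin n → Fin N) : Function.Injective (h.word k) := fun x y e =>
  Subtype.ext (h.orbit_inj k x.2 y.2 (Fin.last n) (congrArg Subtype.val e))

/-- The restriction of `γ_k` to `Y`. -/
def Admissible.letter {γ : Fin N → C(X, X)} {Y : Set X} (h : Admissible γ Y) (k : Fin N)
    (x : Y) : Y := ⟨γ k x, (h.invariant k).1 ⟨_, x.2, rfl⟩⟩

theorem Admissible.letter_injective {γ : Fin N → C(X, X)} {Y : Set X} (h : Admissible γ Y)
    (k : Fin N) : Function.Injective (h.letter k) := fun x y e =>
  Subtype.ext (h.injOn k x.2 y.2 (congrArg Subtype.val e))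

end IFS

/-! ### Operators on `ℓ²` -/

/-- The Hilbert space `ℓ²(ι, G)`, the direct sum of copies of `G` indexed by `ι`. -/
abbrev Ell2 (ι : Type*) (G : Type*) [NormedAddCommGroup G] : Type _ := lp (fun _ : ι => G) 2

namespace Ell2

variable {ι κ : Type*} {G : Type*} [NormedAddCommGroup G] [InnerProductSpace ℂ G]

open scoped Classical in
/-- The inclusion of the summand with index `i`. -/
def incl (i : ι) : G →ₗᵢ[ℂ] Ell2 ι G where
  toFun v := lp.single 2 i v
  map_add' v w := lp.single_add (E := fun _ : ι => G) 2 i v w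
  map_smul' c v := by simpa using lp.single_smul (E := fun _ : ι => G) 2 i c v
  norm_map' v := lp.norm_single (E := fun _ : ι => G) (by norm_num) i v

/-- The standard basis vector `e_i` of `ℓ²(ι)`. -/
def basis (i : ι) : Ell2 ι ℂ := incl i 1

theorem incl_eq_single [DecidableEq ι] (i : ι) (v : G) :
    (incl i v : Ell2 ι G) = lp.single 2 i v := by
  change @lp.single _ (fun _ : ι => G) _ (fun a b => Classical.propDecidable (a = b)) 2 i v =
    lp.single 2 i v
  congr!

theorem incl_orthogonal {φ : ι → κ} (hφ : Function.Injective φ) :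
    OrthogonalFamily ℂ (fun _ : ι => G) (fun i => (incl (φ i) : G →ₗᵢ[ℂ] Ell2 κ G)) := by
  classical
  intro i j hij v w
  rw [incl_eq_single, incl_eq_single, lp.inner_single_left, lp.single_apply_ne, inner_zero_right]
  exact fun e => hij (hφ e)

/-- The isometry that carries the `i`-th summand identically onto the `φ(i)`-th one, for an
injective map `φ`; in particular `e_i ↦ e_{φ(i)}` when `G = ℂ`. -/
def transport [CompleteSpace G] (φ : ι → κ) (hφ : Function.Injective φ) :
    Ell2 ι G →L[ℂ] Ell2 κ G :=
  (incl_orthogonal (G := G) hφ).linearIsometry.toContinuousLinearMap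

theorem transport_incl [CompleteSpace G] (φ : ι → κ) (hφ : Function.Injective φ) (i : ι) (v : G) :
    transport φ hφ (incl i v) = incl (φ i) v := by
  classical
  rw [incl_eq_single]
  exact (incl_orthogonal (G := G) hφ).linearIsometry_apply_single v

/-- The diagonal operator `e_i ↦ f(p(i)) e_i` of a continuous function `f` on a compact space. -/
def diagonal {X : Type*} [TopologicalSpace X] [CompactSpace X] (p : ι → X) (f : C(X, ℂ)) :
    Ell2 ι ℂ →L[ℂ] Ell2 ι ℂ :=
  lp.mapCLM 2 (fun i => f (p i) • ContinuousLinearMap.id ℂ ℂ) (norm_nonneg f) fun i => by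
    simpa [norm_smul] using f.norm_coe_le_norm (p i)

theorem diagonal_apply {X : Type*} [TopologicalSpace X] [CompactSpace X] (p : ι → X) (f : C(X, ℂ))
    (v : Ell2 ι ℂ) (i : ι) : diagonal p f v i = f (p i) * v i := rfl

/-- The operator `α ⊗ 1` on `G ⊗ ℓ²(ℤ) = ℓ²(ℤ, G)`: `α` is applied in every coordinate. -/
def ampl (α : G →L[ℂ] G) : Ell2 ℤ G →L[ℂ] Ell2 ℤ G :=
  lp.mapCLM 2 (fun _ => α) (norm_nonneg α) fun _ => le_rfl

/-- The operator `1 ⊗ υ_k` on `G ⊗ ℓ²(ℤ) = ℓ²(ℤ, G)`, where `υ_k e_n = e_{k+n}`. -/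
def shift [CompleteSpace G] (k : ℤ) : Ell2 ℤ G →L[ℂ] Ell2 ℤ G :=
  transport (fun n => k + n) (add_right_injective k)

/-- The map `α ↦ α ⊗ υ_k` from the operators on `G` to those on `G ⊗ ℓ²(ℤ) = ℓ²(ℤ, G)`. -/
def tensorShift [CompleteSpace G] (k : ℤ) : (G →L[ℂ] G) →ₗ[ℂ] (Ell2 ℤ G →L[ℂ] Ell2 ℤ G) where
  toFun α := ampl α ∘L shift k
  map_add' α β := by ext v n; rfl
  map_smul' c α := by ext v n; rfl

/-- The diagonal operators on `ℓ²(ι)`: every nonzero entry `⟨e_i, α e_j⟩` has `i = j`. -/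
def diagonalOperators (ι : Type*) : Submodule ℂ (Ell2 ι ℂ →L[ℂ] Ell2 ι ℂ) where
  carrier := {α | ∀ i j, inner ℂ (basis i) (α (basis j)) ≠ 0 → i = j}
  zero_mem' i j h := by simp at h
  add_mem' {α β} hα hβ i j h := by
    by_contra hij
    refine h ?_
    have h1 := not_imp_comm.1 (hα i j) hij
    have h2 := not_imp_comm.1 (hβ i j) hij
    rw [add_apply, inner_add_right, h1, h2, add_zero]
  smul_mem' c α hα i j h := by
    refine hα i j fun h0 => h ?_
    rw [smul_apply, inner_smul_right, h0, mul_zero]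

end Ell2

/-! ### Cartan subalgebras -/

section Cartan

variable {B : Type*} [NonUnitalCStarAlgebra B]

/-- The normalizer of a subalgebra. -/
def cstarNormalizer (A : NonUnitalStarSubalgebra ℂ B) : Set B :=
  {b | ∀ a ∈ A, b * a * star b ∈ A ∧ star b * a * b ∈ A}

/-- `A` contains an approximate unit of `B` consisting of positive contractions. -/
def ContainsApproximateUnit (A : NonUnitalStarSubalgebra ℂ B) : Prop :=
  ∃ l : Filter B, l.IsApproximateUnit ∧
    ∀ᶠ a in l, a ∈ A ∧ ‖a‖ ≤ 1 ∧ ∃ c ∈ A, a = star c * c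

/-- `A` is maximal among the abelian C*-subalgebras of `B`. -/
def IsMaximalAbelian (A : NonUnitalStarSubalgebra ℂ B) : Prop :=
  (∀ a ∈ A, ∀ b ∈ A, a * b = b * a) ∧
    ∀ A' : NonUnitalStarSubalgebra ℂ B, IsClosed (A' : Set B) →
      (∀ a ∈ A', ∀ b ∈ A', a * b = b * a) → A ≤ A' → A' = A

/-- The normalizer of `A` generates `B` as a C*-algebra. -/
def IsRegularSubalgebra (A : NonUnitalStarSubalgebra ℂ B) : Prop :=
  (NonUnitalStarAlgebra.adjoin ℂ (cstarNormalizer A)).topologicalClosure = ⊤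

/-- `P` is a conditional expectation of `B` onto `A`. (Complete positivity follows from `pos` and
the two bimodule conditions.) -/
structure IsConditionalExpectation (A : NonUnitalStarSubalgebra ℂ B) (P : B →ₗ[ℂ] B) : Prop where
  mem : ∀ b, P b ∈ A
  fixes : ∀ a ∈ A, P a = a
  contractive : ∀ b, ‖P b‖ ≤ ‖b‖
  pos : ∀ b, ∃ c ∈ A, P (star b * b) = star c * c
  map_left : ∀ a ∈ A, ∀ b, P (a * b) = a * P b
  map_right : ∀ a ∈ A, ∀ b, P (b * a) = P b * a

/-- `A` is a Cartan subalgebra of the C*-algebra `B`. -/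
structure IsCartan (A : NonUnitalStarSubalgebra ℂ B) : Prop where
  isClosed : IsClosed (A : Set B)
  approximateUnit : ContainsApproximateUnit A
  maximalAbelian : IsMaximalAbelian A
  regular : IsRegularSubalgebra A
  expectation : ∃ P : B →ₗ[ℂ] B, IsConditionalExpectation A P ∧
    ∀ b, P (star b * b) = 0 → b = 0

/-- The C*-subalgebra of `B` generated by a set. -/
def cstarGenerated (S : Set B) : NonUnitalStarSubalgebra ℂ B :=
  (NonUnitalStarAlgebra.adjoin ℂ S).topologicalClosure

instance isClosed_cstarGenerated (S : Set B) : IsClosed (cstarGenerated S : Set B) :=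
  NonUnitalStarSubalgebra.isClosed_topologicalClosure _

/-- The subspace `D` of `B` is contained in the C*-subalgebra of `B` generated by `S` and is a
Cartan subalgebra of it. -/
def IsCartanIn (D : Submodule ℂ B) (S : Set B) : Prop :=
  ∃ A : NonUnitalStarSubalgebra ℂ (cstarGenerated S),
    Subtype.val '' (A : Set (cstarGenerated S)) = (D : Set B) ∧ IsCartan A

end Cartan

/-! ### The representations `ρ` and `ρ̂` -/

namespace IFS

variable {X : Type*} [TopologicalSpace X] [CompactSpace X] {N : ℕ}
  {γ : Fin N → C(X, X)} {Y : Set X} (h : Admissible γ Y)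

/-- The `Y`-squared matrices: the bounded operators on `ℓ²(Y)`. -/
abbrev Mat (Y : Set X) : Type _ := Ell2 Y ℂ →L[ℂ] Ell2 Y ℂ

/-- The C*-algebra of bounded operators on `ℓ²(Y) ⊗ ℓ²(ℤ) = ℓ²(ℤ, ℓ²(Y))`, which contains the
spatial tensor product of `Mat Y` and `C*(ℤ)`. -/
abbrev MatHat (Y : Set X) : Type _ := Ell2 ℤ (Ell2 Y ℂ) →L[ℂ] Ell2 ℤ (Ell2 Y ℂ)

/-- `ρ_A(a) e_x = a(x) e_x`. -/
def rhoA (Y : Set X) (a : C(X, ℂ)) : Mat Y := Ell2.diagonal (Subtype.val : Y → X) a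

/-- `ρ_E(f) e_y = ∑_k f(γ_k(y), y) e_{γ_k(y)}`. -/
def rhoE (f : C(graph γ, ℂ)) : Mat Y :=
  ∑ k, Ell2.transport (h.letter k) (h.letter_injective k) ∘L rhoA Y (f.comp (graphMap γ k))

/-- The isometry `e_x ↦ e_{γ_k(x)}` of an index sequence `k`. -/
def wordIsometry {n : ℕ} (k : Fin n → Fin N) : Mat Y :=
  Ell2.transport (h.word k) (h.word_injective k)

/-- `ρ_{m,n}`: the operator `ρ_{m,n}(f)` sends `e_{γ_k(x)}`, for `x ∈ Y` and an index sequence `k`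
of length `n`, to `∑_j f(chain of x along j, chain of x along k) e_{γ_j(x)}`, the sum being over
the index sequences `j` of length `m`, and it sends `e_y` to `0` if `y ∉ γⁿ(Y)`. Indeed the adjoint of
`wordIsometry h k` sends `e_{γ_k(x)}` to `e_x` and `e_y` to `0` if `y ∉ γ_k(Y)`. -/
def rhoBi (m n : ℕ) : C(Bichain γ m n, ℂ) →ₗ[ℂ] Mat Y where
  toFun f := ∑ j : Fin m → Fin N, ∑ k : Fin n → Fin N,
    wordIsometry h j ∘L rhoA Y (f.comp (biorbit γ j k)) ∘L
      ContinuousLinearMap.adjoint (wordIsometry h k)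
  map_add' f g := by
    simp only [← Finset.sum_add_distrib]
    refine Finset.sum_congr rfl fun j _ => Finset.sum_congr rfl fun k _ => ?_
    have e : rhoA Y ((f + g).comp (biorbit γ j k)) =
        rhoA Y (f.comp (biorbit γ j k)) + rhoA Y (g.comp (biorbit γ j k)) := by
      ext v i
      exact add_mul _ _ _
    rw [e, ContinuousLinearMap.add_comp, ContinuousLinearMap.comp_add]
  map_smul' c f := by
    simp only [Finset.smul_sum, RingHom.id_apply]
    refine Finset.sum_congr rfl fun j _ => Finset.sum_congr rfl fun k _ => ?_
    have e : rhoA Y ((c • f).comp (biorbit γ j k)) = c • rhoA Y (f.comp (biorbit γ j k)) := by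
      ext v i
      exact mul_assoc _ _ _
    rw [e, ContinuousLinearMap.smul_comp, ContinuousLinearMap.comp_smul]

/-- `E_{m,n}`, the range of `ρ_{m,n}`. -/
def spaceE (m n : ℕ) : Submodule ℂ (Mat Y) := LinearMap.range (rhoBi h m n)

/-- `B_k`, the closed linear span of the `E_{m,n}` with `m - n = k`. -/
def spaceB (k : ℤ) : Submodule ℂ (Mat Y) :=
  (⨆ (m : ℕ) (n : ℕ) (_ : (m : ℤ) - n = k), spaceE h m n).topologicalClosure

/-- `D_k`, the diagonal matrices in `B_k`. -/
def spaceD (k : ℤ) : Submodule ℂ (Mat Y) := spaceB h k ⊓ Ell2.diagonalOperators Y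

/-- `D̂`, the closed direct sum of the `D_k ⊗ υ_k`. -/
def dHat : Submodule ℂ (MatHat Y) :=
  (⨆ k : ℤ, (spaceD h k).map (Ell2.tensorShift k)).topologicalClosure

/-- `ρ̂_A(a) = ρ_A(a) ⊗ υ_0`. -/
def rhoHatA (Y : Set X) (a : C(X, ℂ)) : MatHat Y := Ell2.tensorShift 0 (rhoA Y a)

/-- `ρ̂_E(f) = ρ_E(f) ⊗ υ_1`. -/
def rhoHatE (f : C(graph γ, ℂ)) : MatHat Y := Ell2.tensorShift 1 (rhoE h f)

/-- The generators of the C*-algebra `C*(ρ̂)`. -/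
def rhoHatGenerators : Set (MatHat Y) := range (rhoHatA Y) ∪ range (rhoHatE h)

end IFS

end

noncomputable section

/-! ### Matrix entries of operators on `ℓ²` -/

namespace Ell2

variable {ι κ : Type*} {G : Type*} [NormedAddCommGroup G] [InnerProductSpace ℂ G]

/-! Write `T = branchOp h`, so that `T e_x = ∑_k e_{γ_k(x)}`. The common left inverse `σ` makes a
chain determined by its last entry, so a function of chains extends to a function of end points, and
the generators of C*(ρ̂) become `a` and `a T ⊗ υ_1` with `a ∈ C(X)`. All of C*(ρ̂) then lies in the
closed span `gradedSpace` of operators whose entries are those of `T^p T^{*q}`, in degree `p - q`,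
times a continuous function (`cstarGenerated_subset`). Because the sets `γ^n(X)` are clopen, entries
of a fixed degree along suitable families of positions extend to continuous functions
(`exists_extension_of_mem_gradedSpace`).

Essential freeness excludes diagonal entries of nonzero degree, so `D̂` is exactly `ρ̂_A(C(X))`
(`dHat_eq`). It contains the unit, it is maximal abelian since `C(X)` separates the points of `Y`,
and restriction to the diagonal is a faithful conditional expectation. None of this uses graph
separation: the theorem is about regularity alone.

If the graphs are separated, the ranges `γ_k(X)` are clopen, and cutting `T ⊗ υ_1` by their
indicators gives the normalizers `e_x ↦ e_{γ_k(x)}` of degree one, which together with `C(X)`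
generate (`isRegular_rhoHatA`).

Conversely let `γ_j(x₀) = γ_k(x₀)` with `j ≠ k`. The degree-one entries of `b` at `(γ_i(x), x)`
extend to one continuous function `a` on the graph. If `b` is a normalizer, `b c b*` is diagonal for
all `c ∈ C(X)`; letting `c` shrink to the indicator of `x` gives `a(γ_j(x), x) · conj a(γ_k(x), x) =
0` for all `x` in a comeager set, where no other degree interferes. By Baire and continuity this
holds at `x₀`, where both factors come from the same point of the graph, so `a` vanishes there. This
passes to the closed span of the normalizers, but fails for `ρ̂_E(1)`, whose function is `1`
(`graphSeparation_of_isRegular`). -/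

theorem ext_incl {E : Type*} [NormedAddCommGroup E] [NormedSpace ℂ E] {f g : Ell2 ι G →L[ℂ] E}
    (h : ∀ i v, f (incl i v) = g (incl i v)) : f = g := by
  classical
  ext v
  have hv := lp.hasSum_single (E := fun _ : ι => G) (p := 2) (by norm_num) v
  refine (hv.mapL f).unique ?_
  have e : (fun i => f (lp.single 2 i (v i))) = fun i => g (lp.single 2 i (v i)) := by
    funext i
    rw [← incl_eq_single, h]
  rw [e]
  exact hv.mapL g

theorem inner_incl_left (i : ι) (v : G) (w : Ell2 ι G) :
    inner ℂ (incl i v) w = inner ℂ v (w i) := by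
  classical
  rw [incl_eq_single, lp.inner_single_left]

theorem incl_apply [DecidableEq ι] (i j : ι) (v : G) :
    (incl i v : Ell2 ι G) j = if j = i then v else 0 := by
  rw [incl_eq_single]
  split_ifs with h
  · subst h
    exact lp.single_apply_self (E := fun _ : ι => G) 2 j v
  · exact lp.single_apply_ne (E := fun _ : ι => G) 2 i v h

theorem inner_basis_left (i : ι) (w : Ell2 ι ℂ) : inner ℂ (basis i) w = w i := by
  rw [basis, inner_incl_left]
  simp

theorem incl_eq_smul_basis (i : ι) (c : ℂ) : (incl i c : Ell2 ι ℂ) = c • basis i := by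
  rw [basis, ← map_smul, smul_eq_mul, mul_one]

theorem norm_basis (i : ι) : ‖(basis i : Ell2 ι ℂ)‖ = 1 := by
  rw [basis, LinearIsometry.norm_map, norm_one]

theorem inner_basis_basis [DecidableEq ι] (i j : ι) :
    inner ℂ (basis i : Ell2 ι ℂ) (basis j) = if i = j then 1 else 0 := by
  rw [inner_basis_left, basis, incl_apply]

theorem inner_basis_self (i : ι) : inner ℂ (basis i : Ell2 ι ℂ) (basis i) = 1 := by
  classical
  rw [inner_basis_basis, if_pos rfl]

theorem inner_basis_of_ne {i j : ι} (hij : i ≠ j) :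
    inner ℂ (basis i : Ell2 ι ℂ) (basis j) = 0 := by
  classical
  rw [inner_basis_basis, if_neg hij]

theorem ext_basis {E : Type*} [NormedAddCommGroup E] [NormedSpace ℂ E] {f g : Ell2 ι ℂ →L[ℂ] E}
    (h : ∀ i, f (basis i) = g (basis i)) : f = g :=
  ext_incl fun i c => by rw [incl_eq_smul_basis, map_smul, map_smul, h]

theorem vec_ext_basis {v w : Ell2 ι ℂ}
    (h : ∀ i, inner ℂ (basis i) v = inner ℂ (basis i) w) : v = w := by
  refine lp.ext (funext fun i => ?_)
  rw [← inner_basis_left, h, inner_basis_left]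

theorem ext_entries {f g : Ell2 ι ℂ →L[ℂ] Ell2 κ ℂ}
    (h : ∀ i j, inner ℂ (basis i) (f (basis j)) = inner ℂ (basis i) (g (basis j))) : f = g :=
  ext_basis fun j => vec_ext_basis fun i => h i j

theorem inner_star (α : Ell2 ι ℂ →L[ℂ] Ell2 ι ℂ) (v w : Ell2 ι ℂ) :
    inner ℂ v (star α w) = inner ℂ (α v) w := by
  rw [ContinuousLinearMap.star_eq_adjoint, ContinuousLinearMap.adjoint_inner_right]

theorem transport_basis (φ : ι → κ) (hφ : Function.Injective φ) (i : ι) :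
    transport φ hφ (basis i : Ell2 ι ℂ) = basis (φ i) :=
  transport_incl φ hφ i 1

section Diagonal

variable {X : Type*} [TopologicalSpace X] [CompactSpace X] (p : ι → X)

theorem diagonal_basis (f : C(X, ℂ)) (i : ι) : diagonal p f (basis i) = f (p i) • basis i := by
  classical
  refine vec_ext_basis fun j => ?_
  rw [inner_smul_right, inner_basis_left, inner_basis_basis, diagonal_apply, basis, incl_apply]
  split_ifs with h
  · rw [h]
  · simp

theorem inner_diagonal (f : C(X, ℂ)) (i : ι) (w : Ell2 ι ℂ) :
    inner ℂ (basis i) (diagonal p f w) = f (p i) * inner ℂ (basis i) w := by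
  rw [inner_basis_left, inner_basis_left, diagonal_apply]

theorem diagonal_mul (f g : C(X, ℂ)) : diagonal p (f * g) = diagonal p f * diagonal p g := by
  ext v i
  exact mul_assoc _ _ _

theorem diagonal_add (f g : C(X, ℂ)) : diagonal p (f + g) = diagonal p f + diagonal p g := by
  ext v i
  exact add_mul _ _ _

theorem diagonal_smul (c : ℂ) (f : C(X, ℂ)) : diagonal p (c • f) = c • diagonal p f := by
  ext v i
  exact mul_assoc _ _ _

theorem diagonal_one : diagonal p (1 : C(X, ℂ)) = 1 := by
  ext v i
  exact one_mul _

theorem star_diagonal (f : C(X, ℂ)) : star (diagonal p f) = diagonal p (star f) := by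
  refine ext_entries fun i j => ?_
  rw [ContinuousLinearMap.star_eq_adjoint, ContinuousLinearMap.adjoint_inner_right,
    diagonal_basis, diagonal_basis, inner_smul_left, inner_smul_right]
  by_cases h : i = j
  · subst h
    rfl
  · rw [inner_basis_of_ne h, mul_zero, mul_zero]

theorem norm_diagonal_le (f : C(X, ℂ)) : ‖diagonal p f‖ ≤ ‖f‖ :=
  lp.norm_mapCLM_le _ _ _ _

end Diagonal

section TensorShift

theorem ampl_incl (α : G →L[ℂ] G) (t : ℤ) (v : G) :
    ampl α (incl t v) = incl t (α v) := by
  refine lp.ext (funext fun s => ?_)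
  change α ((incl t v : Ell2 ℤ G) s) = (incl t (α v) : Ell2 ℤ G) s
  rw [incl_apply, incl_apply]
  split_ifs <;> simp

variable [CompleteSpace G]

theorem tensorShift_incl (k : ℤ) (α : G →L[ℂ] G) (t : ℤ) (v : G) :
    tensorShift k α (incl t v) = incl (k + t) (α v) := by
  change ampl α (shift k (incl t v)) = _
  rw [shift, transport_incl, ampl_incl]

theorem tensorShift_mul (j k : ℤ) (α β : G →L[ℂ] G) :
    tensorShift j α * tensorShift k β = tensorShift (j + k) (α * β) := by
  refine ext_incl fun t v => ?_
  change tensorShift j α (tensorShift k β (incl t v)) = _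
  rw [tensorShift_incl, tensorShift_incl, tensorShift_incl, add_assoc]
  rfl

theorem star_tensorShift (k : ℤ) (α : G →L[ℂ] G) :
    star (tensorShift k α) = tensorShift (-k) (star α) := by
  refine ext_incl fun t v => ?_
  refine ext_inner_left ℂ fun w => ?_
  revert w
  suffices h : ∀ w : Ell2 ℤ G, inner ℂ (tensorShift k α w) (incl t v) =
      inner ℂ w (incl (-k + t) (star α v)) by
    intro w
    rw [ContinuousLinearMap.star_eq_adjoint, ContinuousLinearMap.adjoint_inner_right, h,
      tensorShift_incl]
  intro w
  have e : (innerSL ℂ (incl t v : Ell2 ℤ G)).comp (tensorShift k α) =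
      innerSL ℂ (incl (-k + t) (star α v) : Ell2 ℤ G) := by
    refine ext_incl fun s x => ?_
    simp only [ContinuousLinearMap.comp_apply, innerSL_apply_apply, tensorShift_incl]
    rw [inner_incl_left, inner_incl_left, incl_apply, incl_apply]
    by_cases hs : t = k + s
    · rw [if_pos hs, if_pos (by omega), ContinuousLinearMap.star_eq_adjoint,
        ContinuousLinearMap.adjoint_inner_left]
    · rw [if_neg hs, if_neg (by omega), inner_zero_right, inner_zero_right]
  have e' := congrArg (starRingEnd ℂ) (DFunLike.congr_fun e w)
  simpa [innerSL_apply_apply, inner_conj_symm] using e'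

theorem norm_tensorShift_le (k : ℤ) (α : G →L[ℂ] G) : ‖tensorShift k α‖ ≤ ‖α‖ := by
  have h1 : ‖ampl α‖ ≤ ‖α‖ := lp.norm_mapCLM_le _ _ _ _
  have h2 : ‖(shift k : Ell2 ℤ G →L[ℂ] Ell2 ℤ G)‖ ≤ 1 := LinearIsometry.norm_toContinuousLinearMap_le _
  refine (ContinuousLinearMap.opNorm_comp_le _ _).trans ?_
  calc ‖ampl α‖ * ‖(shift k : Ell2 ℤ G →L[ℂ] Ell2 ℤ G)‖ ≤ ‖α‖ * 1 := by gcongr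
    _ = ‖α‖ := mul_one _

theorem continuous_tensorShift (k : ℤ) :
    Continuous (tensorShift k : (G →L[ℂ] G) →ₗ[ℂ] (Ell2 ℤ G →L[ℂ] Ell2 ℤ G)) :=
  AddMonoidHomClass.continuous_of_bound _ 1 fun α => by
    rw [one_mul]
    exact norm_tensorShift_le k α

end TensorShift

section Entry

/-- The standard basis vector `e_u ⊗ e_s` of `ℓ²(ι) ⊗ ℓ²(ℤ)`. -/
def basisHat (u : ι) (s : ℤ) : Ell2 ℤ (Ell2 ι ℂ) := incl s (basis u)

theorem norm_basisHat (u : ι) (s : ℤ) : ‖basisHat u s‖ = 1 := by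
  rw [basisHat, LinearIsometry.norm_map, norm_basis]

theorem inner_basisHat_left (u : ι) (s : ℤ) (w : Ell2 ℤ (Ell2 ι ℂ)) :
    inner ℂ (basisHat u s) w = w s u := by
  rw [basisHat, inner_incl_left, inner_basis_left]

/-- The entry of an operator at the row `(u, s)` and the column `(v, t)`. -/
def entry (u : ι) (s : ℤ) (v : ι) (t : ℤ) :
    (Ell2 ℤ (Ell2 ι ℂ) →L[ℂ] Ell2 ℤ (Ell2 ι ℂ)) →ₗ[ℂ] ℂ where
  toFun b := inner ℂ (basisHat u s) (b (basisHat v t))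
  map_add' _ _ := inner_add_right _ _ _
  map_smul' _ _ := inner_smul_right _ _ _

theorem entry_def (u : ι) (s : ℤ) (v : ι) (t : ℤ)
    (b : Ell2 ℤ (Ell2 ι ℂ) →L[ℂ] Ell2 ℤ (Ell2 ι ℂ)) :
    entry u s v t b = inner ℂ (basisHat u s) (b (basisHat v t)) := rfl

theorem norm_entry_le (u : ι) (s : ℤ) (v : ι) (t : ℤ)
    (b : Ell2 ℤ (Ell2 ι ℂ) →L[ℂ] Ell2 ℤ (Ell2 ι ℂ)) : ‖entry u s v t b‖ ≤ ‖b‖ := by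
  refine (norm_inner_le_norm (𝕜 := ℂ) (basisHat u s) (b (basisHat v t))).trans ?_
  rw [norm_basisHat, one_mul]
  simpa [norm_basisHat] using b.le_opNorm (basisHat v t)

theorem vec_ext_basisHat {v w : Ell2 ℤ (Ell2 ι ℂ)}
    (h : ∀ u s, inner ℂ (basisHat u s) v = inner ℂ (basisHat u s) w) : v = w := by
  refine lp.ext (funext fun s => lp.ext (funext fun u => ?_))
  rw [← inner_basisHat_left, h, inner_basisHat_left]

theorem ext_basisHat {f g : Ell2 ℤ (Ell2 ι ℂ) →L[ℂ] Ell2 ℤ (Ell2 ι ℂ)}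
    (h : ∀ v t, f (basisHat v t) = g (basisHat v t)) : f = g := by
  refine ext_incl fun t v => ?_
  have e : f.comp (incl t : Ell2 ι ℂ →ₗᵢ[ℂ] _).toContinuousLinearMap =
      g.comp (incl t : Ell2 ι ℂ →ₗᵢ[ℂ] _).toContinuousLinearMap :=
    ext_basis fun i => h i t
  exact DFunLike.congr_fun e v

theorem ext_entry {f g : Ell2 ℤ (Ell2 ι ℂ) →L[ℂ] Ell2 ℤ (Ell2 ι ℂ)}
    (h : ∀ u s v t, entry u s v t f = entry u s v t g) : f = g :=
  ext_basisHat fun v t => vec_ext_basisHat fun u s => h u s v t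

theorem tensorShift_basisHat (k : ℤ) (α : Ell2 ι ℂ →L[ℂ] Ell2 ι ℂ) (v : ι) (t : ℤ) :
    tensorShift k α (basisHat v t) = incl (k + t) (α (basis v)) :=
  tensorShift_incl k α t _

theorem entry_tensorShift (k : ℤ) (α : Ell2 ι ℂ →L[ℂ] Ell2 ι ℂ) (u : ι) (s : ℤ) (v : ι) (t : ℤ) :
    entry u s v t (tensorShift k α) = if s = k + t then inner ℂ (basis u) (α (basis v)) else 0 := by
  rw [entry_def, tensorShift_basisHat, basisHat, inner_incl_left, incl_apply]
  split_ifs <;> simp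

theorem entry_star (u : ι) (s : ℤ) (v : ι) (t : ℤ)
    (b : Ell2 ℤ (Ell2 ι ℂ) →L[ℂ] Ell2 ℤ (Ell2 ι ℂ)) :
    entry u s v t (star b) = star (entry v t u s b) := by
  rw [entry_def, entry_def, ContinuousLinearMap.star_eq_adjoint,
    ContinuousLinearMap.adjoint_inner_right]
  exact (inner_conj_symm _ _).symm

theorem entry_star_mul_self (b : Ell2 ℤ (Ell2 ι ℂ) →L[ℂ] Ell2 ℤ (Ell2 ι ℂ)) (x : ι) (s : ℤ) :
    entry x s x s (star b * b) = ((‖b (basisHat x s)‖ ^ 2 : ℝ) : ℂ) := by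
  have e : entry x s x s (star b * b) =
      inner ℂ (basisHat x s) (star b (b (basisHat x s))) := rfl
  rw [e, ContinuousLinearMap.star_eq_adjoint, ContinuousLinearMap.adjoint_inner_right,
    inner_self_eq_norm_sq_to_K]
  push_cast
  rfl

end Entry

end Ell2

/-! ### Words and the partial isometries of an iterated function system -/

namespace IFS

section Words

variable {X : Type*} [TopologicalSpace X] {N : ℕ} {γ : Fin N → C(X, X)} {Y : Set X}

theorem orbit_castSucc {n : ℕ} (k : Fin (n + 1) → Fin N) (x : X) (i : Fin (n + 1)) :
    orbit γ k x i.castSucc = orbit γ (k ∘ Fin.castSucc) x i := by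
  induction i using Fin.induction with
  | zero => simp [orbit]
  | succ i ih =>
    rw [← Fin.succ_castSucc]
    simp only [orbit, Fin.induction_succ] at ih ⊢
    rw [ih]
    rfl

theorem wordMap_succ {n : ℕ} (k : Fin (n + 1) → Fin N) (x : X) :
    wordMap γ k x = γ (k (Fin.last n)) (wordMap γ (k ∘ Fin.castSucc) x) := by
  rw [wordMap, wordMap, ← orbit_castSucc, ← Fin.succ_last]
  simp only [orbit, Fin.induction_succ]

theorem wordMap_snoc {n : ℕ} (k : Fin n → Fin N) (i : Fin N) (x : X) :
    wordMap γ (Fin.snoc k i : Fin (n + 1) → Fin N) x = γ i (wordMap γ k x) := by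
  have e : (Fin.snoc k i : Fin (n + 1) → Fin N) ∘ Fin.castSucc = k := by
    funext l
    simp
  rw [wordMap_succ, e, Fin.snoc_last]

theorem continuous_wordMap {n : ℕ} (k : Fin n → Fin N) : Continuous (wordMap γ k) :=
  (continuous_apply _).comp (continuous_orbit γ k)

/-- The composition along a word as a continuous map. -/
def wordC {n : ℕ} (k : Fin n → Fin N) : C(X, X) := ⟨wordMap γ k, continuous_wordMap k⟩

theorem mem_image_iff {S : Set X} {u : X} : u ∈ image γ S ↔ ∃ k, ∃ x ∈ S, γ k x = u := by
  simp [image]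

variable (h : Admissible γ Y)
include h

theorem Admissible.letter_eq_iff {j k : Fin N} {x y : Y} :
    h.letter j x = h.letter k y ↔ j = k ∧ x = y := by
  refine ⟨fun e => ?_, fun e => by rw [e.1, e.2]⟩
  by_cases hjk : j = k
  · subst hjk
    exact ⟨rfl, h.letter_injective j e⟩
  · exact absurd (congrArg Subtype.val e)
      ((h.disjoint j k hjk).ne_of_mem ⟨x, x.2, rfl⟩ ⟨y, y.2, rfl⟩)

theorem Admissible.word_succ {n : ℕ} (k : Fin (n + 1) → Fin N) (x : Y) :
    h.word k x = h.letter (k (Fin.last n)) (h.word (k ∘ Fin.castSucc) x) :=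
  Subtype.ext (wordMap_succ k x.1)

theorem Admissible.word_snoc {n : ℕ} (k : Fin n → Fin N) (i : Fin N) (x : Y) :
    h.word (Fin.snoc k i : Fin (n + 1) → Fin N) x = h.letter i (h.word k x) :=
  Subtype.ext (wordMap_snoc k i x.1)

theorem Admissible.word_zero (k : Fin 0 → Fin N) (x : Y) : h.word k x = x := rfl

/-- Within `Y` the images of the letters are disjoint and each letter is injective, so the last
letter of an address can be read off and removed; a point has at most one address of a given length.
-/
theorem Admissible.word_eq_iff {n : ℕ} {j k : Fin n → Fin N} {x y : Y} :
    h.word j x = h.word k y ↔ j = k ∧ x = y := by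
  refine ⟨fun e => ?_, fun e => by rw [e.1, e.2]⟩
  induction n with
  | zero => exact ⟨Subsingleton.elim _ _, e⟩
  | succ n ih =>
    rw [h.word_succ, h.word_succ, h.letter_eq_iff] at e
    obtain ⟨e1, e2⟩ := e
    obtain ⟨e3, e4⟩ := ih e2
    refine ⟨funext fun i => ?_, e4⟩
    induction i using Fin.lastCases with
    | last => exact e1
    | cast i => exact congrFun e3 i

/-- Invariance of `Y` under preimages keeps the ancestors of a point of `Y` inside `Y`. -/
theorem Admissible.exists_letter {S : Set X} {u : Y} (hu : u.1 ∈ image γ S) :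
    ∃ k, ∃ x : Y, x.1 ∈ S ∧ u = h.letter k x := by
  obtain ⟨k, x, hx, e⟩ := mem_image_iff.1 hu
  exact ⟨k, ⟨x, (h.invariant k).2 (by rw [mem_preimage, e]; exact u.2)⟩, hx, Subtype.ext e.symm⟩

theorem Admissible.exists_word {n : ℕ} {u : Y} (hu : u.1 ∈ (image γ)^[n] univ) :
    ∃ (k : Fin n → Fin N) (x : Y), u = h.word k x := by
  induction n generalizing u with
  | zero => exact ⟨Fin.elim0, u, rfl⟩
  | succ n ih =>
    rw [Function.iterate_succ_apply'] at hu
    obtain ⟨i, x, hx, rfl⟩ := h.exists_letter hu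
    obtain ⟨k, y, rfl⟩ := ih hx
    exact ⟨Fin.snoc k i, y, (h.word_snoc k i y).symm⟩

end Words

section Operators

variable {X : Type*} [TopologicalSpace X] {N : ℕ}
  {γ : Fin N → C(X, X)} {Y : Set X} (h : Admissible γ Y)

/-- The isometry `e_x ↦ e_{γ_k(x)}`. -/
def letterIsometry (k : Fin N) : Mat Y := Ell2.transport (h.letter k) (h.letter_injective k)

/-- The operator `e_x ↦ ∑_k e_{γ_k(x)}`. -/
def branchOp : Mat Y := ∑ k, letterIsometry h k

theorem letterIsometry_basis (k : Fin N) (x : Y) :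
    letterIsometry h k (Ell2.basis x) = Ell2.basis (h.letter k x) :=
  Ell2.transport_basis _ _ _

theorem wordIsometry_basis {n : ℕ} (k : Fin n → Fin N) (x : Y) :
    wordIsometry h k (Ell2.basis x) = Ell2.basis (h.word k x) :=
  Ell2.transport_basis _ _ _

theorem star_letterIsometry_basis_self (k : Fin N) (x : Y) :
    star (letterIsometry h k) (Ell2.basis (h.letter k x)) = Ell2.basis x := by
  classical
  refine Ell2.vec_ext_basis fun y => ?_
  rw [Ell2.inner_star, letterIsometry_basis, Ell2.inner_basis_basis, Ell2.inner_basis_basis]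
  simp [h.letter_eq_iff]

theorem star_letterIsometry_basis_of_forall_ne {k : Fin N} {u : Y} (hu : ∀ x, h.letter k x ≠ u) :
    star (letterIsometry h k) (Ell2.basis u) = 0 := by
  refine Ell2.vec_ext_basis fun y => ?_
  rw [Ell2.inner_star, letterIsometry_basis, Ell2.inner_basis_of_ne (hu y), inner_zero_right]

theorem star_wordIsometry_basis_self {n : ℕ} (k : Fin n → Fin N) (x : Y) :
    star (wordIsometry h k) (Ell2.basis (h.word k x)) = Ell2.basis x := by
  classical
  refine Ell2.vec_ext_basis fun y => ?_
  rw [Ell2.inner_star, wordIsometry_basis, Ell2.inner_basis_basis, Ell2.inner_basis_basis]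
  simp [h.word_eq_iff]

theorem star_wordIsometry_basis_of_forall_ne {n : ℕ} {k : Fin n → Fin N} {u : Y}
    (hu : ∀ x, h.word k x ≠ u) : star (wordIsometry h k) (Ell2.basis u) = 0 := by
  refine Ell2.vec_ext_basis fun y => ?_
  rw [Ell2.inner_star, wordIsometry_basis, Ell2.inner_basis_of_ne (hu y), inner_zero_right]

theorem star_wordIsometry_basis {n : ℕ} (j k : Fin n → Fin N) (x : Y) :
    star (wordIsometry h j) (Ell2.basis (h.word k x)) = if j = k then Ell2.basis x else 0 := by
  split_ifs with hjk
  · rw [hjk, star_wordIsometry_basis_self]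
  · exact star_wordIsometry_basis_of_forall_ne h fun y e => hjk (h.word_eq_iff.1 e).1

theorem branchOp_basis (x : Y) :
    branchOp h (Ell2.basis x) = ∑ k, Ell2.basis (h.letter k x) := by
  rw [branchOp, sum_apply]
  exact Finset.sum_congr rfl fun k _ => letterIsometry_basis h k x

/-- Only the branch `k` reaches `γ_k(x)` from `Y`, so `T*` acts on addresses by deleting the last
letter. -/
theorem star_branchOp_basis_letter (k : Fin N) (x : Y) :
    star (branchOp h) (Ell2.basis (h.letter k x)) = Ell2.basis x := by
  rw [branchOp, star_sum, sum_apply, Finset.sum_eq_single k]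
  · exact star_letterIsometry_basis_self h k x
  · intro j _ hj
    exact star_letterIsometry_basis_of_forall_ne h fun y e => hj (h.letter_eq_iff.1 e).1
  · simp

theorem star_branchOp_basis_of_notMem {u : Y} (hu : u.1 ∉ image γ univ) :
    star (branchOp h) (Ell2.basis u) = 0 := by
  rw [branchOp, star_sum, sum_apply]
  refine Finset.sum_eq_zero fun k _ => star_letterIsometry_basis_of_forall_ne h fun x e => hu ?_
  exact mem_image_iff.2 ⟨k, x, mem_univ _, congrArg Subtype.val e⟩

theorem star_branchOp_pow_basis_word {r p : ℕ} (k : Fin (r + p) → Fin N) (x : Y) :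
    (star (branchOp h) ^ p) (Ell2.basis (h.word k x)) =
      Ell2.basis (h.word (k ∘ Fin.castAdd p) x) := by
  induction p with
  | zero => rfl
  | succ p ih =>
    rw [pow_succ]
    change (star (branchOp h) ^ p) (star (branchOp h) (Ell2.basis (h.word (n := r + p + 1) k x))) = _
    rw [h.word_succ, star_branchOp_basis_letter, ih]
    rfl

theorem star_branchOp_pow_basis_word_self {p : ℕ} (k : Fin p → Fin N) (x : Y) :
    (star (branchOp h) ^ p) (Ell2.basis (h.word k x)) = Ell2.basis x := by
  induction p with
  | zero => rfl
  | succ p ih =>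
    rw [pow_succ]
    change (star (branchOp h) ^ p) (star (branchOp h) (Ell2.basis (h.word k x))) = _
    rw [h.word_succ, star_branchOp_basis_letter, ih]

theorem star_branchOp_pow_basis_of_notMem {p : ℕ} {u : Y} (hu : u.1 ∉ (image γ)^[p] univ) :
    (star (branchOp h) ^ p) (Ell2.basis u) = 0 := by
  induction p generalizing u with
  | zero => exact absurd (mem_univ _) hu
  | succ p ih =>
    rw [pow_succ]
    change (star (branchOp h) ^ p) (star (branchOp h) (Ell2.basis u)) = _
    by_cases hu1 : u.1 ∈ image γ univ
    · obtain ⟨k, x, -, rfl⟩ := h.exists_letter hu1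
      rw [star_branchOp_basis_letter]
      refine ih fun hx => hu ?_
      rw [Function.iterate_succ_apply']
      exact mem_image_iff.2 ⟨k, x, hx, rfl⟩
    · rw [star_branchOp_basis_of_notMem h hu1, map_zero]

/-- The entry of `T^p T^{*q}` at the row `u` and the column `v`, where `T = branchOp h`: it is `1` if
`u` and `v` arise from a common point by words of lengths `p` and `q`, and `0` otherwise. -/
def overlap (p q : ℕ) (u v : Y) : ℂ :=
  inner ℂ ((star (branchOp h) ^ p) (Ell2.basis u)) ((star (branchOp h) ^ q) (Ell2.basis v))

theorem exists_word_of_overlap_ne_zero {p q : ℕ} {u v : Y} (ho : overlap h p q u v ≠ 0) :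
    ∃ (j : Fin p → Fin N) (k : Fin q → Fin N) (x : Y), u = h.word j x ∧ v = h.word k x := by
  have hu : u.1 ∈ (image γ)^[p] univ := by
    by_contra hu
    exact ho (by rw [overlap, star_branchOp_pow_basis_of_notMem h hu, inner_zero_left])
  have hv : v.1 ∈ (image γ)^[q] univ := by
    by_contra hv
    exact ho (by rw [overlap, star_branchOp_pow_basis_of_notMem h hv, inner_zero_right])
  obtain ⟨j, x, rfl⟩ := h.exists_word hu
  obtain ⟨k, y, rfl⟩ := h.exists_word hv
  have hxy : x = y := by
    by_contra hxy
    refine ho ?_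
    rw [overlap, star_branchOp_pow_basis_word_self, star_branchOp_pow_basis_word_self,
      Ell2.inner_basis_of_ne hxy]
  exact ⟨j, k, x, rfl, by rw [hxy]⟩

theorem overlap_self_of_mem {r : ℕ} {x : Y} (hx : x.1 ∈ (image γ)^[r] univ) :
    overlap h r r x x = 1 := by
  obtain ⟨k, y, rfl⟩ := h.exists_word hx
  rw [overlap, star_branchOp_pow_basis_word_self, Ell2.inner_basis_self]

theorem overlap_self_of_notMem {r : ℕ} {x : Y} (hx : x.1 ∉ (image γ)^[r] univ) :
    overlap h r r x x = 0 := by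
  rw [overlap, star_branchOp_pow_basis_of_notMem h hx, inner_zero_left]

/-- `T*` first consumes the letters of both words; what remains compares `x` with itself and tests
whether `x` lies in `γ^r(X)`. -/
theorem overlap_word_add {m n : ℕ} (j : Fin m → Fin N) (k : Fin n → Fin N) (x : Y) (r : ℕ) :
    overlap h (r + m) (r + n) (h.word j x) (h.word k x) = overlap h r r x x := by
  rw [overlap, pow_add, pow_add]
  change inner ℂ ((star (branchOp h) ^ r) ((star (branchOp h) ^ m) _))
    ((star (branchOp h) ^ r) ((star (branchOp h) ^ n) _)) = _
  rw [star_branchOp_pow_basis_word_self, star_branchOp_pow_basis_word_self]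
  rfl

/-- Here `T*` removes only part of each word. Both sides test equality of the first `r` letters of
`j` and `k`, which does not involve the point. -/
theorem overlap_word_of_add {p q r : ℕ} (j : Fin (r + p) → Fin N) (k : Fin (r + q) → Fin N)
    (x y : Y) : overlap h p q (h.word j x) (h.word k x) =
      overlap h p q (h.word j y) (h.word k y) := by
  classical
  simp only [overlap, star_branchOp_pow_basis_word, Ell2.inner_basis_basis, h.word_eq_iff, and_true]

end Operators

end IFS

/-! ### Functionals that are interpolated by continuous functions -/

section Extension

variable {B Z I : Type*} [NormedAddCommGroup B] [NormedSpace ℂ B] [TopologicalSpace Z]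

theorem ContinuousMap.eq_of_denseRange {P : I → Z} (hP : DenseRange P) {a a' : C(Z, ℂ)}
    (e : ∀ i, a (P i) = a' (P i)) : a = a' :=
  DFunLike.coe_injective (hP.equalizer a.continuous a'.continuous (funext e))

variable [CompactSpace Z]

theorem ContinuousMap.norm_le_of_denseRange {P : I → Z} (hP : DenseRange P) {a : C(Z, ℂ)} {C : ℝ}
    (hC : 0 ≤ C) (e : ∀ i, ‖a (P i)‖ ≤ C) : ‖a‖ ≤ C :=
  (ContinuousMap.norm_le a hC).2 fun z => hP.induction_on (p := fun z => ‖a z‖ ≤ C) z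
    (isClosed_le (continuous_norm.comp a.continuous) continuous_const) e

/-- The elements on which the values of the functionals `L i` are interpolated by a function in
`W`. -/
def extensionSpace (P : I → Z) (L : I → B →ₗ[ℂ] ℂ) (W : Submodule ℂ C(Z, ℂ)) : Submodule ℂ B where
  carrier := {b | ∃ a ∈ W, ∀ i, L i b = a (P i)}
  zero_mem' := ⟨0, W.zero_mem, fun i => by simp⟩
  add_mem' := by
    rintro b c ⟨a, ha, hb⟩ ⟨a', ha', hc⟩
    exact ⟨a + a', W.add_mem ha ha', fun i => by simp [hb, hc]⟩
  smul_mem' := by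
    rintro c b ⟨a, ha, hb⟩
    exact ⟨c • a, W.smul_mem c ha, fun i => by simp [hb]⟩

/-- Density of `P` and contractivity of `L` bound the distance of two interpolating functions by
that of the operators, so a convergent sequence of operators has a uniformly convergent sequence of
interpolating functions. -/
theorem isClosed_extensionSpace {P : I → Z} (hP : DenseRange P) {L : I → B →ₗ[ℂ] ℂ}
    (hL : ∀ i b, ‖L i b‖ ≤ ‖b‖) {W : Submodule ℂ C(Z, ℂ)} (hW : IsClosed (W : Set C(Z, ℂ))) :
    IsClosed (extensionSpace P L W : Set B) := by
  refine IsSeqClosed.isClosed fun b x hb hx => ?_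
  choose a haW ha using hb
  have hc : CauchySeq a := by
    refine Metric.cauchySeq_iff.2 fun ε hε => ?_
    obtain ⟨n, hn⟩ := Metric.cauchySeq_iff.1 hx.cauchySeq ε hε
    refine ⟨n, fun m hm l hl => (hn m hm l hl).trans_le' ?_⟩
    rw [dist_eq_norm, dist_eq_norm]
    refine ContinuousMap.norm_le_of_denseRange hP (norm_nonneg _) fun i => ?_
    rw [ContinuousMap.sub_apply, ← ha, ← ha, ← map_sub]
    exact hL i _
  obtain ⟨f, hf⟩ := cauchySeq_tendsto_of_complete hc
  refine ⟨f, hW.mem_of_tendsto hf (Filter.Eventually.of_forall haW), fun i => ?_⟩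
  have hLi : Continuous (L i) :=
    AddMonoidHomClass.continuous_of_bound (L i) 1 fun b => by simpa using hL i b
  refine tendsto_nhds_unique ((hLi.tendsto x).comp hx) ?_
  have := ((continuous_eval_const (F := C(Z, ℂ)) (P i)).tendsto f).comp hf
  refine this.congr fun n => ?_
  exact (ha n i).symm

end Extension

/-! ### The closed graded space of operators with continuous symbols -/

namespace IFS

section Graded

variable {X : Type*} [TopologicalSpace X] {N : ℕ}
  {γ : Fin N → C(X, X)} {Y : Set X} (h : Admissible γ Y)

/-- The matrices whose entries are those of `T^p T^{*q}`, multiplied by a continuous function. -/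
def symbolSpace (p q : ℕ) : Submodule ℂ (Mat Y) where
  carrier := {α | ∃ F : C(X × X, ℂ), ∀ u v : Y,
    inner ℂ (Ell2.basis u) (α (Ell2.basis v)) = F (u, v) * overlap h p q u v}
  zero_mem' := ⟨0, fun u v => by simp⟩
  add_mem' := by
    rintro α β ⟨F, hF⟩ ⟨F', hF'⟩
    exact ⟨F + F', fun u v => by
      rw [add_apply, inner_add_right, hF, hF', ContinuousMap.add_apply, add_mul]⟩
  smul_mem' := by
    rintro c α ⟨F, hF⟩
    exact ⟨c • F, fun u v => by
      rw [smul_apply, inner_smul_right, hF, ContinuousMap.smul_apply, smul_eq_mul, mul_assoc]⟩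

/-- The closed linear span of the spaces `symbolSpace h p q ⊗ υ_{p - q}`. -/
def gradedSpace : Submodule ℂ (MatHat Y) :=
  (⨆ p : ℕ, ⨆ q : ℕ, (symbolSpace h p q).map (Ell2.tensorShift ((p : ℤ) - q))).topologicalClosure

theorem isClosed_gradedSpace : IsClosed (gradedSpace h : Set (MatHat Y)) :=
  Submodule.isClosed_topologicalClosure _

theorem tensorShift_mem_gradedSpace {p q : ℕ} {k : ℤ} (hk : (p : ℤ) - q = k) {α : Mat Y}
    (hα : α ∈ symbolSpace h p q) : Ell2.tensorShift k α ∈ gradedSpace h := by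
  subst hk
  refine Submodule.le_topologicalClosure _ (Submodule.mem_iSup_of_mem p
    (Submodule.mem_iSup_of_mem q ?_))
  exact Submodule.mem_map_of_mem hα

theorem gradedSpace_le {Q : Submodule ℂ (MatHat Y)} (hQ : IsClosed (Q : Set (MatHat Y)))
    (hmem : ∀ (p q : ℕ), ∀ α ∈ symbolSpace h p q, Ell2.tensorShift ((p : ℤ) - q) α ∈ Q) :
    gradedSpace h ≤ Q := by
  refine Submodule.topologicalClosure_minimal _ (iSup_le fun p => iSup_le fun q => ?_) hQ
  rintro _ ⟨α, hα, rfl⟩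
  exact hmem p q α hα

variable {h}

theorem continuous_entry {ι : Type*} (u : ι) (s : ℤ) (v : ι) (t : ℤ) :
    Continuous (Ell2.entry u s v t) :=
  AddMonoidHomClass.continuous_of_bound (Ell2.entry u s v t) 1 fun b => by
    simpa using Ell2.norm_entry_le u s v t b

theorem exists_overlap_ne_zero_of_entry_ne_zero {b : MatHat Y} (hb : b ∈ gradedSpace h) {u v : Y}
    {s t : ℤ} (he : Ell2.entry u s v t b ≠ 0) :
    ∃ p q : ℕ, (p : ℤ) - q = s - t ∧ overlap h p q u v ≠ 0 := by
  by_contra! hno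
  refine he (gradedSpace_le h (Q := LinearMap.ker (Ell2.entry u s v t)) ?_ ?_ hb)
  · exact isClosed_singleton.preimage (continuous_entry u s v t)
  · rintro p q α ⟨F, hF⟩
    rw [LinearMap.mem_ker, Ell2.entry_tensorShift]
    split_ifs with hs
    · rw [hF, hno p q (by omega), mul_zero]
    · rfl

/-- The factor `F` of a symbol is continuous along any continuous family of positions, and symbols
of another degree contribute zero. Only the overlaps of degree `d` need to be extended, and the
property then passes to the closed span. -/
theorem exists_extension_of_mem_gradedSpace {b : MatHat Y} (hb : b ∈ gradedSpace h)
    {Z I : Type*} [TopologicalSpace Z] [CompactSpace Z] {P : I → Z} (hP : DenseRange P)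
    (u v : I → Y) (f g : C(Z, X)) (hu : ∀ i, f (P i) = u i) (hv : ∀ i, g (P i) = v i) (d : ℤ)
    (hχ : ∀ p q : ℕ, (p : ℤ) - q = d → ∃ χ : C(Z, ℂ), ∀ i, overlap h p q (u i) (v i) = χ (P i)) :
    ∃ a : C(Z, ℂ), ∀ i s t, s - t = d → Ell2.entry (u i) s (v i) t b = a (P i) := by
  -- Indexing by all pairs `(s, t)` of difference `d` makes one function serve every such pair;
  -- density survives because the projection to `I` is onto.
  let J := I × {st : ℤ × ℤ // st.1 - st.2 = d}
  let L : J → MatHat Y →ₗ[ℂ] ℂ := fun i => Ell2.entry (u i.1) i.2.1.1 (v i.1) i.2.1.2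
  have hP' : DenseRange (fun i : J => P i.1) := by
    have hs : Function.Surjective (Prod.fst : J → I) := fun i => ⟨(i, ⟨(d, 0), by simp⟩), rfl⟩
    change Dense (range (P ∘ Prod.fst))
    rw [hs.range_comp]
    exact hP
  have key : gradedSpace h ≤ extensionSpace (fun i : J => P i.1) L ⊤ := by
    refine gradedSpace_le h (isClosed_extensionSpace hP' (fun i b => Ell2.norm_entry_le _ _ _ _ b)
      isClosed_univ) ?_
    rintro p q α ⟨F, hF⟩
    by_cases hd : (p : ℤ) - q = d
    · obtain ⟨χ, hχ⟩ := hχ p q hd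
      refine ⟨F.comp (f.prodMk g) * χ, trivial, fun i => ?_⟩
      have hst := i.2.2
      rw [Ell2.entry_tensorShift, if_pos (by omega), hF, hχ]
      simp [hu, hv]
    · refine ⟨0, trivial, fun i => ?_⟩
      have hst := i.2.2
      rw [Ell2.entry_tensorShift, if_neg (by omega)]
      rfl
  obtain ⟨a, -, ha⟩ := key hb
  exact ⟨a, fun i s t hst => ha (i, ⟨(s, t), hst⟩)⟩

/-- The indicator function of a clopen set. -/
def clopenIndicator {S : Set X} (hS : IsClopen S) : C(X, ℂ) :=
  ⟨S.indicator fun _ => 1, continuous_const.indicator fun x hx => by simp [hS.frontier_eq] at hx⟩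

theorem overlap_self_eq (h : Admissible γ Y) (hclopen : ∀ n : ℕ, IsClopen ((image γ)^[n] univ)) (r : ℕ) (x : Y) :
    overlap h r r x x = clopenIndicator (hclopen r) x := by
  by_cases hx : x.1 ∈ (image γ)^[r] univ
  · rw [overlap_self_of_mem h hx]
    exact (indicator_of_mem hx fun _ => (1 : ℂ)).symm
  · rw [overlap_self_of_notMem h hx]
    exact (indicator_of_notMem hx fun _ => (1 : ℂ)).symm

end Graded

/-! ### Continuous extension of matrix entries, and operators that are diagonal over `Y` -/

section Continuity

variable {X : Type*} [TopologicalSpace X] [CompactSpace X] {N : ℕ}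
  {γ : Fin N → C(X, X)} {Y : Set X} {h : Admissible γ Y}

/-- Since `p - q = m - n`, either both `p ≥ m` and `q ≥ n`, and the overlap is the indicator of a
clopen set, or both words outlast `p` and `q`, and the overlap is constant in `x`. -/
theorem exists_extension_word (hclopen : ∀ n : ℕ, IsClopen ((image γ)^[n] univ)) {b : MatHat Y}
    (hb : b ∈ gradedSpace h) {m n : ℕ} (j : Fin m → Fin N) (k : Fin n → Fin N) :
    ∃ a : C(X, ℂ), ∀ (x : Y) (s t : ℤ), s - t = (m : ℤ) - n →
      Ell2.entry (h.word j x) s (h.word k x) t b = a x := by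
  refine exists_extension_of_mem_gradedSpace hb h.dense.denseRange_val (h.word j) (h.word k)
    (wordC j) (wordC k) (fun _ => rfl) (fun _ => rfl) _ fun p q hpq => ?_
  obtain ⟨r, rfl | rfl⟩ : ∃ r, p = r + m ∨ m = r + p := by
    rcases le_total p m with hle | hle
    · exact ⟨m - p, Or.inr (by omega)⟩
    · exact ⟨p - m, Or.inl (by omega)⟩
  · obtain rfl : q = r + n := by omega
    exact ⟨clopenIndicator (hclopen r), fun x => by rw [overlap_word_add, overlap_self_eq h hclopen]⟩
  · obtain rfl : n = r + q := by omega
    -- A point of `Y` is needed only to name the constant.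
    rcases isEmpty_or_nonempty Y with hY | ⟨⟨y⟩⟩
    · exact ⟨0, fun x => hY.elim x⟩
    · exact ⟨ContinuousMap.const X (overlap h p q (h.word j y) (h.word k y)), fun x =>
        overlap_word_of_add h j k x y⟩

theorem exists_extension_diagonal (hclopen : ∀ n : ℕ, IsClopen ((image γ)^[n] univ)) {b : MatHat Y}
    (hb : b ∈ gradedSpace h) : ∃ a : C(X, ℂ), ∀ (x : Y) (s : ℤ), Ell2.entry x s x s b = a x := by
  obtain ⟨a, ha⟩ := exists_extension_word hclopen hb (Fin.elim0 : Fin 0 → Fin N) Fin.elim0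
  exact ⟨a, fun x s => ha x s s (by simp)⟩

theorem rhoHatA_basisHat (a : C(X, ℂ)) (v : Y) (t : ℤ) :
    rhoHatA Y a (Ell2.basisHat v t) = a v • Ell2.basisHat v t := by
  rw [rhoHatA, Ell2.tensorShift_basisHat, rhoA, Ell2.diagonal_basis, map_smul, zero_add]
  rfl

theorem star_rhoHatA (a : C(X, ℂ)) : star (rhoHatA Y a) = rhoHatA Y (star a) := by
  rw [rhoHatA, Ell2.star_tensorShift, rhoA, Ell2.star_diagonal, neg_zero]
  rfl

theorem entry_rhoHatA_mul (a : C(X, ℂ)) (b : MatHat Y) (u : Y) (s : ℤ) (v : Y) (t : ℤ) :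
    Ell2.entry u s v t (rhoHatA Y a * b) = a u * Ell2.entry u s v t b := by
  have e : Ell2.entry u s v t (rhoHatA Y a * b) =
      inner ℂ (star (rhoHatA Y a) (Ell2.basisHat u s)) (b (Ell2.basisHat v t)) := by
    rw [ContinuousLinearMap.star_eq_adjoint, ContinuousLinearMap.adjoint_inner_left]
    rfl
  rw [e, star_rhoHatA, rhoHatA_basisHat, inner_smul_left]
  simp [Ell2.entry_def]

theorem entry_mul_rhoHatA (a : C(X, ℂ)) (b : MatHat Y) (u : Y) (s : ℤ) (v : Y) (t : ℤ) :
    Ell2.entry u s v t (b * rhoHatA Y a) = Ell2.entry u s v t b * a v := by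
  have e : Ell2.entry u s v t (b * rhoHatA Y a) =
      inner ℂ (Ell2.basisHat u s) (b (rhoHatA Y a (Ell2.basisHat v t))) := rfl
  rw [e, rhoHatA_basisHat, map_smul, inner_smul_right, mul_comm]
  rfl

theorem entry_rhoHatA_self (a : C(X, ℂ)) (u : Y) (s : ℤ) :
    Ell2.entry u s u s (rhoHatA Y a) = a u := by
  rw [rhoHatA, Ell2.entry_tensorShift, if_pos (by simp), rhoA, Ell2.diagonal_basis,
    inner_smul_right, Ell2.inner_basis_self, mul_one]

theorem entry_rhoHatA_of_ne (a : C(X, ℂ)) {u v : Y} (huv : u ≠ v) (s t : ℤ) :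
    Ell2.entry u s v t (rhoHatA Y a) = 0 := by
  rw [rhoHatA, Ell2.entry_tensorShift, rhoA, Ell2.diagonal_basis,
    inner_smul_right, Ell2.inner_basis_of_ne huv, mul_zero, ite_self]

theorem entry_rhoHatA_of_ne_shift (a : C(X, ℂ)) (u v : Y) {s t : ℤ} (hst : s ≠ t) :
    Ell2.entry u s v t (rhoHatA Y a) = 0 := by
  rw [rhoHatA, Ell2.entry_tensorShift, if_neg (by simpa using hst)]

/-- A nonzero entry would give `u = γ_j(x) = γ_k(x)` for words of different lengths. The entry
varies continuously with `x` and vanishes wherever the two words disagree, which by essential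
freeness is a dense set. -/
theorem entry_eq_zero_of_blockDiagonal [T2Space X] (hfree : EssentiallyFree γ)
    (hclopen : ∀ n : ℕ, IsClopen ((image γ)^[n] univ))
    {b : MatHat Y} (hb : b ∈ gradedSpace h)
    (hdiag : ∀ (u : Y) (s : ℤ) (v : Y) (t : ℤ), u ≠ v → Ell2.entry u s v t b = 0)
    (u : Y) {s t : ℤ} (hst : s ≠ t) : Ell2.entry u s u t b = 0 := by
  by_contra hne
  obtain ⟨p, q, hpq, ho⟩ := exists_overlap_ne_zero_of_entry_ne_zero hb hne
  obtain ⟨j, k, x, huj, huk⟩ := exists_word_of_overlap_ne_zero h ho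
  obtain ⟨a, ha⟩ := exists_extension_word hclopen hb j k
  have hjk : (⟨p, j⟩ : (n : ℕ) × (Fin n → Fin N)) ≠ ⟨q, k⟩ := by
    intro e
    have := congrArg Sigma.fst e
    simp only at this
    omega
  have hnd := hfree _ _ hjk
  have hclosed : IsClosed {x : X | wordMap γ j x = wordMap γ k x} :=
    isClosed_eq (continuous_wordMap j) (continuous_wordMap k)
  -- The coincidence set is closed and nowhere dense, so its complement is open and dense and meets
  -- `Y` in a dense set.
  have hdense : Dense (Y ∩ {x : X | wordMap γ j x = wordMap γ k x}ᶜ) := by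
    refine h.dense.inter_of_isOpen_right ?_ hclosed.isOpen_compl
    rw [← interior_eq_empty_iff_dense_compl, ← hclosed.closure_eq]
    exact hnd
  have ha0 : a = 0 := by
    refine ContinuousMap.eq_of_denseRange hdense.denseRange_val fun y => ?_
    rw [← ha ⟨y, y.2.1⟩ s t hpq.symm]
    exact hdiag _ _ _ _ fun e => y.2.2 (congrArg Subtype.val e)
  refine hne ?_
  have := ha x s t hpq.symm
  rwa [← huj, ← huk, ha0] at this

theorem eq_rhoHatA_of_blockDiagonal [T2Space X] (hfree : EssentiallyFree γ)
    (hclopen : ∀ n : ℕ, IsClopen ((image γ)^[n] univ))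
    {b : MatHat Y} (hb : b ∈ gradedSpace h)
    (hdiag : ∀ (u : Y) (s : ℤ) (v : Y) (t : ℤ), u ≠ v → Ell2.entry u s v t b = 0) :
    ∃ a, b = rhoHatA Y a := by
  obtain ⟨a, ha⟩ := exists_extension_diagonal hclopen hb
  refine ⟨a, Ell2.ext_entry fun u s v t => ?_⟩
  by_cases huv : u = v
  · subst huv
    by_cases hst : s = t
    · subst hst
      rw [ha, entry_rhoHatA_self]
    · rw [entry_rhoHatA_of_ne_shift a u u hst,
        entry_eq_zero_of_blockDiagonal hfree hclopen hb hdiag u hst]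
  · rw [hdiag u s v t huv, entry_rhoHatA_of_ne a huv]

end Continuity

end IFS

namespace IFS

/-! ### Functions of chains are functions of end points -/

section Chains

variable {X : Type*} [TopologicalSpace X] {N : ℕ} {γ : Fin N → C(X, X)}

/-- The maps `γ_k` have a common left inverse. -/
def JointlyInjective (γ : Fin N → C(X, X)) : Prop := ∀ j k x y, γ j x = γ k y → x = y

theorem jointlyInjective_of_leftInverse
    (hσ : ∃ σ : C(image γ univ, X), ∀ (k : Fin N) (x : X) (hx : γ k x ∈ image γ univ),
      σ ⟨γ k x, hx⟩ = x) : JointlyInjective γ := by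
  obtain ⟨σ, hσ⟩ := hσ
  intro j k x y e
  have hx : γ j x ∈ image γ univ := mem_image_iff.2 ⟨j, x, mem_univ _, rfl⟩
  have hy : γ k y ∈ image γ univ := mem_image_iff.2 ⟨k, y, mem_univ _, rfl⟩
  rw [← hσ j x hx, ← hσ k y hy]
  congr 1
  exact Subtype.ext e

theorem orbit_succ {n : ℕ} (k : Fin n → Fin N) (x : X) (i : Fin n) :
    orbit γ k x i.succ = γ (k i) (orbit γ k x i.castSucc) := by
  simp [orbit]

theorem exists_orbit_eq {n : ℕ} (c : Chain γ n) : ∃ k, orbit γ k (c.1 0) = c.1 := by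
  choose k hk using c.2
  refine ⟨k, funext fun i => ?_⟩
  induction i using Fin.induction with
  | zero => rfl
  | succ i ih => rw [orbit_succ, ih, hk i]

theorem exists_biorbit_eq {m n : ℕ} (z : Bichain γ m n) : ∃ j k x, biorbit γ j k x = z := by
  obtain ⟨⟨c, d⟩, hcd⟩ := z
  obtain ⟨j, hj⟩ := exists_orbit_eq c
  obtain ⟨k, hk⟩ := exists_orbit_eq d
  refine ⟨j, k, c.1 0, Subtype.ext (Prod.ext (Subtype.ext hj) (Subtype.ext ?_))⟩
  have e : c.1 0 = d.1 0 := hcd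
  change orbit γ k (c.1 0) = d.1
  rw [e, hk]

/-- Joint injectivity recovers every entry of a chain from its successor, whichever letters were
used. -/
theorem chain_ext_last (hinj : JointlyInjective γ) {n : ℕ} {c d : Fin (n + 1) → X}
    (hc : c ∈ Chain γ n) (hd : d ∈ Chain γ n) (e : c (Fin.last n) = d (Fin.last n)) : c = d := by
  funext i
  induction i using Fin.reverseInduction with
  | last => exact e
  | cast i ih =>
    obtain ⟨j, hj⟩ := hc i
    obtain ⟨k, hk⟩ := hd i
    exact hinj j k _ _ (by rw [← hj, ← hk, ih])

variable [CompactSpace X]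

instance compactSpace_bichain (m n : ℕ) : CompactSpace (Bichain γ m n) := by
  have e : (univ : Set (Bichain γ m n)) = ⋃ j, ⋃ k, range (biorbit γ j k) := by
    refine (eq_univ_of_forall fun z => ?_).symm
    obtain ⟨j, k, x, rfl⟩ := exists_biorbit_eq z
    exact mem_iUnion.2 ⟨j, mem_iUnion.2 ⟨k, x, rfl⟩⟩
  refine ⟨?_⟩
  rw [e]
  exact isCompact_iUnion fun j => isCompact_iUnion fun k =>
    isCompact_range (biorbit γ j k).continuous

instance compactSpace_graph : CompactSpace (graph γ) := by
  have e : (univ : Set (graph γ)) = ⋃ k, range (graphMap γ k) := by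
    refine (eq_univ_of_forall fun z => ?_).symm
    obtain ⟨⟨x, y⟩, k, hk⟩ := z
    exact mem_iUnion.2 ⟨k, y, Subtype.ext (Prod.ext hk.symm rfl)⟩
  refine ⟨?_⟩
  rw [e]
  exact isCompact_iUnion fun k => isCompact_range (graphMap γ k).continuous

variable [T2Space X]

/-- The end-point map embeds the compact space of bichains as a closed subset of `X × X`; Tietze
extends the function from there. -/
theorem exists_endpoint_function (hinj : JointlyInjective γ) {m n : ℕ} (f : C(Bichain γ m n, ℂ)) :
    ∃ F : C(X × X, ℂ), ∀ j k x, F (wordMap γ j x, wordMap γ k x) = f (biorbit γ j k x) := by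
  let e : Bichain γ m n → X × X := fun z => (z.1.1.1 (Fin.last m), z.1.2.1 (Fin.last n))
  have he : IsClosedEmbedding e := by
    refine Continuous.isClosedEmbedding ?_ fun z w hzw => ?_
    · exact ((continuous_apply _).comp (continuous_subtype_val.comp
        (continuous_fst.comp continuous_subtype_val))).prodMk
          ((continuous_apply _).comp (continuous_subtype_val.comp
            (continuous_snd.comp continuous_subtype_val)))
    · refine Subtype.ext (Prod.ext (Subtype.ext ?_) (Subtype.ext ?_))
      · exact chain_ext_last hinj z.1.1.2 w.1.1.2 (congrArg Prod.fst hzw)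
      · exact chain_ext_last hinj z.1.2.2 w.1.2.2 (congrArg Prod.snd hzw)
  obtain ⟨F, hF⟩ := ContinuousMap.exists_extension he f
  exact ⟨F, fun j k x => DFunLike.congr_fun hF (biorbit γ j k x)⟩

theorem exists_graph_function (hinj : JointlyInjective γ) (f : C(graph γ, ℂ)) :
    ∃ a : C(X, ℂ), ∀ k y, a (γ k y) = f (graphMap γ k y) := by
  have he : IsClosedEmbedding (fun z : graph γ => z.1.1) := by
    refine (continuous_fst.comp continuous_subtype_val).isClosedEmbedding fun z w hzw => ?_
    obtain ⟨⟨x, y⟩, j, hj⟩ := z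
    obtain ⟨⟨x', y'⟩, k, hk⟩ := w
    have hx : x = x' := hzw
    exact Subtype.ext (Prod.ext hx (hinj j k _ _ (hj.symm.trans (hx.trans hk))))
  obtain ⟨a, ha⟩ := ContinuousMap.exists_extension he f
  exact ⟨a, fun k y => DFunLike.congr_fun ha (graphMap γ k y)⟩

/-- This gives the commutation rule `T c = a T`, by which functions are moved to the left of `T`. -/
theorem exists_lift_function (hinj : JointlyInjective γ) (c : C(X, ℂ)) :
    ∃ a : C(X, ℂ), ∀ k y, a (γ k y) = c y :=
  exists_graph_function hinj (c.comp ⟨fun z : graph γ => z.1.2,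
    continuous_snd.comp continuous_subtype_val⟩)

end Chains

/-! ### The algebra C*(ρ̂) inside the graded space, and the identification of `D̂` -/

section Generated

variable {X : Type*} [TopologicalSpace X] [CompactSpace X] {N : ℕ}
  {γ : Fin N → C(X, X)} {Y : Set X} (h : Admissible γ Y)

theorem rhoBi_apply {m n : ℕ} (f : C(Bichain γ m n, ℂ)) (u v : Y) :
    inner ℂ (Ell2.basis u) (rhoBi h m n f (Ell2.basis v)) =
      ∑ j : Fin m → Fin N, ∑ k : Fin n → Fin N,
        inner ℂ (star (wordIsometry h j) (Ell2.basis u))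
          (rhoA Y (f.comp (biorbit γ j k)) (star (wordIsometry h k) (Ell2.basis v))) := by
  change inner ℂ (Ell2.basis u) ((∑ j : Fin m → Fin N, ∑ k : Fin n → Fin N,
    wordIsometry h j ∘L rhoA Y (f.comp (biorbit γ j k)) ∘L
      ContinuousLinearMap.adjoint (wordIsometry h k)) (Ell2.basis v)) = _
  simp only [sum_apply, inner_sum, ContinuousLinearMap.comp_apply]
  refine Finset.sum_congr rfl fun j _ => Finset.sum_congr rfl fun k _ => ?_
  rw [ContinuousLinearMap.star_eq_adjoint, ContinuousLinearMap.adjoint_inner_left,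
    ContinuousLinearMap.star_eq_adjoint]

/-- By uniqueness of addresses at most one pair of words contributes to an entry, and it does so
exactly when the two base points agree, which is what the overlap detects. -/
theorem rhoBi_mem_symbolSpace [T2Space X] (hinj : JointlyInjective γ) {m n : ℕ} (f : C(Bichain γ m n, ℂ)) :
    rhoBi h m n f ∈ symbolSpace h m n := by
  obtain ⟨F, hF⟩ := exists_endpoint_function hinj f
  refine ⟨F, fun u v => ?_⟩
  rw [rhoBi_apply]
  by_cases hu : ∃ (i : Fin m → Fin N) (x : Y), h.word i x = u
  swap
  · have ho : overlap h m n u v = 0 := by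
      by_contra ho
      obtain ⟨i, -, x, e, -⟩ := exists_word_of_overlap_ne_zero h ho
      exact hu ⟨i, x, e.symm⟩
    rw [ho, mul_zero]
    refine Finset.sum_eq_zero fun j _ => Finset.sum_eq_zero fun k _ => ?_
    rw [star_wordIsometry_basis_of_forall_ne h fun x e => hu ⟨j, x, e⟩, inner_zero_left]
  by_cases hv : ∃ (i : Fin n → Fin N) (x : Y), h.word i x = v
  swap
  · have ho : overlap h m n u v = 0 := by
      by_contra ho
      obtain ⟨-, i, x, -, e⟩ := exists_word_of_overlap_ne_zero h ho
      exact hv ⟨i, x, e.symm⟩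
    rw [ho, mul_zero]
    refine Finset.sum_eq_zero fun j _ => Finset.sum_eq_zero fun k _ => ?_
    rw [star_wordIsometry_basis_of_forall_ne h fun x e => hv ⟨k, x, e⟩, map_zero, inner_zero_right]
  obtain ⟨i, x, rfl⟩ := hu
  obtain ⟨l, y, rfl⟩ := hv
  rw [overlap, star_branchOp_pow_basis_word_self, star_branchOp_pow_basis_word_self,
    Finset.sum_eq_single i, Finset.sum_eq_single l]
  · rw [star_wordIsometry_basis_self, star_wordIsometry_basis_self, rhoA, Ell2.inner_diagonal]
    by_cases hxy : x = y
    · subst hxy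
      congr 1
      exact (hF i l x).symm
    · rw [Ell2.inner_basis_of_ne hxy, mul_zero, mul_zero]
  · intro k _ hk
    rw [star_wordIsometry_basis h k l, if_neg hk, map_zero, inner_zero_right]
  · simp
  · intro j _ hj
    refine Finset.sum_eq_zero fun k _ => ?_
    rw [star_wordIsometry_basis h j i, if_neg hj, inner_zero_left]
  · simp

theorem tensorShift_spaceB_mem [T2Space X] (hinj : JointlyInjective γ) {k : ℤ} {α : Mat Y}
    (hα : α ∈ spaceB h k) : Ell2.tensorShift k α ∈ gradedSpace h := by
  have hle : spaceB h k ≤ (gradedSpace h).comap (Ell2.tensorShift k) := by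
    refine Submodule.topologicalClosure_minimal _ ?_
      ((isClosed_gradedSpace h).preimage (Ell2.continuous_tensorShift k))
    refine iSup_le fun m => iSup_le fun n => iSup_le fun hmn => ?_
    rintro _ ⟨f, rfl⟩
    exact tensorShift_mem_gradedSpace h hmn (rhoBi_mem_symbolSpace h hinj f)
  exact hle hα

/-! ### Relations between the generators -/

theorem rhoA_basis (a : C(X, ℂ)) (x : Y) : rhoA Y a (Ell2.basis x) = a x • Ell2.basis x :=
  Ell2.diagonal_basis _ a x

theorem rhoA_mul (a b : C(X, ℂ)) : rhoA Y (a * b) = rhoA Y a * rhoA Y b := Ell2.diagonal_mul _ a b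

theorem star_rhoA (a : C(X, ℂ)) : star (rhoA Y a) = rhoA Y (star a) := Ell2.star_diagonal _ a

theorem rhoA_one : rhoA Y (1 : C(X, ℂ)) = 1 := Ell2.diagonal_one _

theorem letterIsometry_mul_rhoA {k : Fin N} {a c : C(X, ℂ)} (hac : ∀ y, a (γ k y) = c y) :
    letterIsometry h k * rhoA Y c = rhoA Y a * letterIsometry h k := by
  refine Ell2.ext_basis fun x => ?_
  change letterIsometry h k (rhoA Y c (Ell2.basis x)) = rhoA Y a (letterIsometry h k (Ell2.basis x))
  rw [rhoA_basis, map_smul, letterIsometry_basis, rhoA_basis, ← hac]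
  rfl

theorem exists_rhoE_eq [T2Space X] (hinj : JointlyInjective γ) (f : C(graph γ, ℂ)) :
    ∃ a, rhoE h f = rhoA Y a * branchOp h := by
  obtain ⟨a, ha⟩ := exists_graph_function hinj f
  refine ⟨a, ?_⟩
  rw [branchOp, Finset.mul_sum, rhoE]
  exact Finset.sum_congr rfl fun k _ => letterIsometry_mul_rhoA h (ha k)

theorem exists_branchOp_pow_mul_rhoA [T2Space X] (hinj : JointlyInjective γ) (n : ℕ) (c : C(X, ℂ)) :
    ∃ a, branchOp h ^ n * rhoA Y c = rhoA Y a * branchOp h ^ n := by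
  induction n generalizing c with
  | zero => exact ⟨c, by simp⟩
  | succ n ih =>
    obtain ⟨a, ha⟩ := exists_lift_function hinj c
    obtain ⟨a', ha'⟩ := ih a
    have e : branchOp h * rhoA Y c = rhoA Y a * branchOp h := by
      rw [branchOp, Finset.sum_mul, Finset.mul_sum]
      exact Finset.sum_congr rfl fun k _ => letterIsometry_mul_rhoA h (ha k)
    exact ⟨a', by rw [pow_succ, mul_assoc, e, ← mul_assoc, ha', mul_assoc]⟩

theorem exists_rhoA_mul_star_branchOp_pow [T2Space X] (hinj : JointlyInjective γ) (n : ℕ) (c : C(X, ℂ)) :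
    ∃ a, rhoA Y c * star (branchOp h) ^ n = star (branchOp h) ^ n * rhoA Y a := by
  obtain ⟨a, ha⟩ := exists_branchOp_pow_mul_rhoA h hinj n (star c)
  refine ⟨star a, ?_⟩
  have := congrArg star ha
  rwa [star_mul, star_mul, star_rhoA, star_rhoA, star_star, star_pow] at this

/-- Compression by `T` is the transfer operator: `T* c T` is multiplication by `∑_k c ∘ γ_k`. -/
theorem exists_star_branchOp_pow_mul_rhoA_mul (n : ℕ) (c : C(X, ℂ)) :
    ∃ a, star (branchOp h) ^ n * rhoA Y c * branchOp h ^ n = rhoA Y a := by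
  induction n generalizing c with
  | zero => exact ⟨c, by simp⟩
  | succ n ih =>
    have e : star (branchOp h) * rhoA Y c * branchOp h = rhoA Y (∑ k, c.comp (γ k)) := by
      refine Ell2.ext_basis fun x => ?_
      change star (branchOp h) (rhoA Y c (branchOp h (Ell2.basis x))) = _
      rw [branchOp_basis, map_sum, map_sum, rhoA_basis, ContinuousMap.sum_apply, Finset.sum_smul]
      refine Finset.sum_congr rfl fun k _ => ?_
      rw [rhoA_basis, map_smul, star_branchOp_basis_letter]
      rfl
    obtain ⟨a, ha⟩ := ih (∑ k, c.comp (γ k))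
    refine ⟨a, ?_⟩
    rw [← ha, ← e, pow_succ, pow_succ']
    simp only [mul_assoc]

/-- The operators `a T^p T^{*q} b ⊗ υ_{p - q}`, where `T = branchOp h`. -/
def monomials : Set (MatHat Y) := {x | ∃ (p q : ℕ) (a b : C(X, ℂ)),
  x = Ell2.tensorShift ((p : ℤ) - q) (rhoA Y a * branchOp h ^ p * star (branchOp h) ^ q * rhoA Y b)}

theorem monomials_subset : monomials h ⊆ gradedSpace h := by
  rintro _ ⟨p, q, a, b, rfl⟩
  refine tensorShift_mem_gradedSpace h rfl
    ⟨(a.comp ContinuousMap.fst) * (b.comp ContinuousMap.snd), fun u v => ?_⟩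
  change inner ℂ (Ell2.basis u) (rhoA Y a ((branchOp h ^ p)
    ((star (branchOp h) ^ q) (rhoA Y b (Ell2.basis v))))) = _
  rw [rhoA_basis, map_smul, map_smul, rhoA, Ell2.inner_diagonal, inner_smul_right, overlap,
    ← Ell2.inner_star, star_pow, star_star]
  exact (mul_assoc _ _ _).symm

/-- In the middle factor `T^{*n} c T^p` the smaller of the two powers cancels into a function by the
transfer operator; that function is then moved outward past the other powers, to the left if `n ≤ p`
and to the right if `p ≤ n`. -/
theorem monomials_mul_mem [T2Space X] (hinj : JointlyInjective γ) {x y : MatHat Y} (hx : x ∈ monomials h)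
    (hy : y ∈ monomials h) : x * y ∈ monomials h := by
  obtain ⟨m, n, a, b, rfl⟩ := hx
  obtain ⟨p, q, c, d, rfl⟩ := hy
  rw [Ell2.tensorShift_mul]
  set T := branchOp h with hT
  have e : rhoA Y a * T ^ m * star T ^ n * rhoA Y b * (rhoA Y c * T ^ p * star T ^ q * rhoA Y d) =
      rhoA Y a * T ^ m * (star T ^ n * rhoA Y (b * c) * T ^ p) * star T ^ q * rhoA Y d := by
    rw [rhoA_mul]
    simp only [mul_assoc]
  rw [e]
  rcases le_total n p with hnp | hnp
  · obtain ⟨r, rfl⟩ := Nat.exists_eq_add_of_le hnp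
    obtain ⟨f, hf⟩ := exists_star_branchOp_pow_mul_rhoA_mul h n (b * c)
    obtain ⟨g, hg⟩ := exists_branchOp_pow_mul_rhoA h hinj m f
    refine ⟨m + r, q, a * g, d, ?_⟩
    have e1 : star T ^ n * rhoA Y (b * c) * T ^ (n + r) = rhoA Y f * T ^ r := by
      rw [pow_add, ← mul_assoc, hf]
    have e2 : rhoA Y a * T ^ m * (rhoA Y f * T ^ r) = rhoA Y (a * g) * T ^ (m + r) := by
      rw [rhoA_mul, pow_add, mul_assoc, ← mul_assoc (T ^ m), hg]
      simp only [mul_assoc, hT]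
    rw [e1, e2]
    congr 1
    push_cast
    congr 1
    omega
  · obtain ⟨r, rfl⟩ := Nat.exists_eq_add_of_le hnp
    obtain ⟨f, hf⟩ := exists_star_branchOp_pow_mul_rhoA_mul h p (b * c)
    obtain ⟨g, hg⟩ := exists_rhoA_mul_star_branchOp_pow h hinj q f
    refine ⟨m, r + q, a, g * d, ?_⟩
    have e1 : star T ^ (p + r) * rhoA Y (b * c) * T ^ p = star T ^ r * rhoA Y f := by
      rw [add_comm, pow_add, mul_assoc, mul_assoc, ← mul_assoc (star T ^ p), hf]
    have e2 : star T ^ r * rhoA Y f * star T ^ q * rhoA Y d =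
        star T ^ (r + q) * rhoA Y (g * d) := by
      rw [rhoA_mul, pow_add, mul_assoc (star T ^ r), hg]
      simp only [mul_assoc, hT]
    rw [e1]
    have e3 : rhoA Y a * T ^ m * (star T ^ r * rhoA Y f) * star T ^ q * rhoA Y d =
        rhoA Y a * T ^ m * star T ^ (r + q) * rhoA Y (g * d) := by
      rw [mul_assoc (rhoA Y a * T ^ m), mul_assoc (rhoA Y a * T ^ m), e2, mul_assoc (rhoA Y a * T ^ m)]
    rw [e3]
    congr 1
    push_cast
    congr 1
    omega

theorem monomials_star_mem {x : MatHat Y} (hx : x ∈ monomials h) : star x ∈ monomials h := by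
  obtain ⟨m, n, a, b, rfl⟩ := hx
  refine ⟨n, m, star b, star a, ?_⟩
  rw [Ell2.star_tensorShift]
  simp only [star_mul, star_rhoA, star_pow, star_star, mul_assoc, neg_sub]

theorem generators_subset_monomials [T2Space X] (hinj : JointlyInjective γ) :
    rhoHatGenerators h ⊆ monomials h := by
  rintro _ (⟨a, rfl⟩ | ⟨f, rfl⟩)
  · refine ⟨0, 0, a, 1, ?_⟩
    rw [rhoA_one]
    simp [rhoHatA]
  · obtain ⟨a, ha⟩ := exists_rhoE_eq h hinj f
    refine ⟨1, 0, a, 1, ?_⟩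
    rw [rhoA_one, rhoHatE, ha]
    simp

theorem cstarGenerated_subset [T2Space X] (hinj : JointlyInjective γ) {b : MatHat Y}
    (hb : b ∈ cstarGenerated (rhoHatGenerators h)) : b ∈ gradedSpace h := by
  have hstar : ∀ x ∈ Submodule.span ℂ (monomials h), star x ∈ Submodule.span ℂ (monomials h) := by
    intro x hx
    induction hx using Submodule.span_induction with
    | mem x hx => exact Submodule.subset_span (monomials_star_mem h hx)
    | zero => rw [star_zero]; exact Submodule.zero_mem _
    | add x y _ _ hx hy => rw [star_add]; exact Submodule.add_mem _ hx hy
    | smul c x _ hx => rw [star_smul]; exact Submodule.smul_mem _ _ hx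
  have hspan : ∀ x ∈ NonUnitalStarAlgebra.adjoin ℂ (rhoHatGenerators h),
      x ∈ Submodule.span ℂ (monomials h) := by
    intro x hx
    induction hx using NonUnitalStarAlgebra.adjoin_induction with
    | mem x hx => exact Submodule.subset_span (generators_subset_monomials h hinj hx)
    | add x y _ _ hx hy => exact Submodule.add_mem _ hx hy
    | zero => exact Submodule.zero_mem _
    | mul x y _ _ hx hy =>
      have hxy := Submodule.mul_mem_mul hx hy
      rw [Submodule.span_mul_span] at hxy
      refine Submodule.span_mono ?_ hxy
      rintro _ ⟨x, hx, y, hy, rfl⟩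
      exact monomials_mul_mem h hinj hx hy
    | smul r x _ hx => exact Submodule.smul_mem _ _ hx
    | star x _ hx => exact hstar x hx
  have hb' : b ∈ closure (NonUnitalStarAlgebra.adjoin ℂ (rhoHatGenerators h) : Set (MatHat Y)) := hb
  exact closure_minimal (fun x hx => Submodule.span_le.2 (monomials_subset h) (hspan x hx))
    (isClosed_gradedSpace h) hb'

theorem rhoHatA_mem (a : C(X, ℂ)) : rhoHatA Y a ∈ cstarGenerated (rhoHatGenerators h) :=
  subset_closure (NonUnitalStarAlgebra.subset_adjoin ℂ _ (Or.inl ⟨a, rfl⟩))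

theorem rhoHatE_mem (f : C(graph γ, ℂ)) : rhoHatE h f ∈ cstarGenerated (rhoHatGenerators h) :=
  subset_closure (NonUnitalStarAlgebra.subset_adjoin ℂ _ (Or.inr ⟨f, rfl⟩))

/-- The representation of `C(X)` on `ℓ²(Y) ⊗ ℓ²(ℤ)` as a linear map. -/
def rhoHatALinear (Y : Set X) : C(X, ℂ) →ₗ[ℂ] MatHat Y where
  toFun := rhoHatA Y
  map_add' a b := by rw [rhoHatA, rhoA, Ell2.diagonal_add, map_add]; rfl
  map_smul' c a := by rw [rhoHatA, rhoA, Ell2.diagonal_smul, map_smul]; rfl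

theorem norm_rhoHatA_le (a : C(X, ℂ)) : ‖rhoHatA Y a‖ ≤ ‖a‖ :=
  (Ell2.norm_tensorShift_le _ _).trans (Ell2.norm_diagonal_le _ a)

include h in
theorem norm_rhoHatA (a : C(X, ℂ)) : ‖rhoHatA Y a‖ = ‖a‖ := by
  refine (norm_rhoHatA_le a).antisymm ?_
  refine ContinuousMap.norm_le_of_denseRange h.dense.denseRange_val (norm_nonneg _) fun u => ?_
  rw [← entry_rhoHatA_self a u 0]
  exact Ell2.norm_entry_le _ _ _ _ _

include h in
theorem isClosed_range_rhoHatA : IsClosed (range (rhoHatA Y)) := by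
  have hi : Isometry (rhoHatALinear Y) :=
    AddMonoidHomClass.isometry_of_norm (rhoHatALinear Y) (norm_rhoHatA h)
  exact hi.isClosedEmbedding.isClosed_range

/-- Diagonal operators in `B_k ⊗ υ_k` lie in the graded space and are diagonal over `Y`, hence come
from `C(X)`. In the other direction `ρ_A(a)` is `ρ_{0,0}` of `a`, since a bichain of length `(0, 0)`
is just a point. -/
theorem dHat_eq [T2Space X] (hinj : JointlyInjective γ) (hfree : EssentiallyFree γ)
    (hclopen : ∀ n : ℕ, IsClopen ((image γ)^[n] univ)) :
    (dHat h : Set (MatHat Y)) = range (rhoHatA Y) := by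
  refine Subset.antisymm ?_ ?_
  · change dHat h ≤ LinearMap.range (rhoHatALinear Y)
    refine Submodule.topologicalClosure_minimal _ (iSup_le fun k => ?_) (isClosed_range_rhoHatA h)
    rintro _ ⟨α, ⟨hα, hdiag⟩, rfl⟩
    obtain ⟨a, ha⟩ := eq_rhoHatA_of_blockDiagonal hfree hclopen (tensorShift_spaceB_mem h hinj hα)
      fun u s v t huv => by
        rw [Ell2.entry_tensorShift]
        split_ifs
        · by_contra hne
          exact huv (hdiag u v hne)
        · rfl
    exact ⟨a, ha.symm⟩
  · rintro _ ⟨a, rfl⟩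
    refine Submodule.le_topologicalClosure _ (Submodule.mem_iSup_of_mem 0 ?_)
    refine ⟨rhoA Y a, ⟨?_, fun u v hne => ?_⟩, rfl⟩
    · refine Submodule.le_topologicalClosure _ (Submodule.mem_iSup_of_mem 0
        (Submodule.mem_iSup_of_mem 0 (Submodule.mem_iSup_of_mem (by simp) ?_)))
      refine ⟨a.comp ⟨fun z : Bichain γ 0 0 => z.1.1.1 0, (continuous_apply _).comp
        (continuous_subtype_val.comp (continuous_fst.comp continuous_subtype_val))⟩, ?_⟩
      refine Ell2.ext_entries fun u v => ?_
      rw [rhoBi_apply, Fintype.sum_unique, Fintype.sum_unique]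
      rw [← h.word_zero default u, ← h.word_zero default v, star_wordIsometry_basis_self,
        star_wordIsometry_basis_self]
      rfl
    · by_contra huv
      refine hne ?_
      rw [rhoA_basis, inner_smul_right, Ell2.inner_basis_of_ne huv, mul_zero]

end Generated

end IFS

/-! ### Generation of C*-subalgebras -/

section Generation

variable {B : Type*} [NonUnitalCStarAlgebra B]

theorem subset_cstarGenerated (S : Set B) : S ⊆ cstarGenerated S := fun _ hx =>
  subset_closure (NonUnitalStarAlgebra.subset_adjoin ℂ S hx)

theorem eq_top_of_generators_mem {S : Set B} {A : NonUnitalStarSubalgebra ℂ (cstarGenerated S)}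
    (hA : IsClosed (A : Set (cstarGenerated S)))
    (hS : ∀ x (hx : x ∈ S), (⟨x, subset_cstarGenerated S hx⟩ : cstarGenerated S) ∈ A) : A = ⊤ := by
  have hclosed : IsClosed (Subtype.val '' (A : Set (cstarGenerated S))) :=
    (isClosed_cstarGenerated S).isClosedEmbedding_subtypeVal.isClosedMap _ hA
  have hadj : ∀ x ∈ NonUnitalStarAlgebra.adjoin ℂ S,
      x ∈ Subtype.val '' (A : Set (cstarGenerated S)) := by
    intro x hx
    induction hx using NonUnitalStarAlgebra.adjoin_induction with
    | mem x hx => exact ⟨_, hS x hx, rfl⟩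
    | add x y _ _ hx hy =>
      obtain ⟨⟨x, hx, rfl⟩, y, hy, rfl⟩ := hx, hy
      exact ⟨x + y, add_mem hx hy, rfl⟩
    | zero => exact ⟨0, zero_mem A, rfl⟩
    | mul x y _ _ hx hy =>
      obtain ⟨⟨x, hx, rfl⟩, y, hy, rfl⟩ := hx, hy
      exact ⟨x * y, mul_mem hx hy, rfl⟩
    | smul r x _ hx =>
      obtain ⟨x, hx, rfl⟩ := hx
      exact ⟨r • x, SMulMemClass.smul_mem r hx, rfl⟩
    | star x _ hx =>
      obtain ⟨x, hx, rfl⟩ := hx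
      exact ⟨star x, star_mem hx, rfl⟩
  refine eq_top_iff.2 fun x _ => ?_
  obtain ⟨y, hy, hyx⟩ := closure_minimal hadj hclosed x.2
  rwa [← Subtype.ext hyx]

theorem mul_mem_cstarNormalizer {A : NonUnitalStarSubalgebra ℂ B} {b c : B}
    (hb : b ∈ cstarNormalizer A) (hc : c ∈ cstarNormalizer A) : b * c ∈ cstarNormalizer A := by
  intro a ha
  have h1 := (hb _ (hc a ha).1).1
  have h2 := (hc _ (hb a ha).2).2
  constructor
  · convert h1 using 1
    simp only [star_mul, mul_assoc]
  · convert h2 using 1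
    simp only [star_mul, mul_assoc]

theorem star_mem_cstarNormalizer {A : NonUnitalStarSubalgebra ℂ B} {b : B}
    (hb : b ∈ cstarNormalizer A) : star b ∈ cstarNormalizer A := fun a ha =>
  ⟨by rw [star_star]; exact (hb a ha).2, by rw [star_star]; exact (hb a ha).1⟩

/-- Normalizers are closed under products and adjoints. Regularity can therefore be tested on closed
linear subspaces, which need not be algebras. -/
theorem adjoin_cstarNormalizer_subset_span {A : NonUnitalStarSubalgebra ℂ B} {x : B}
    (hx : x ∈ NonUnitalStarAlgebra.adjoin ℂ (cstarNormalizer A)) :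
    x ∈ Submodule.span ℂ (cstarNormalizer A) := by
  have hstar : ∀ x ∈ Submodule.span ℂ (cstarNormalizer A),
      star x ∈ Submodule.span ℂ (cstarNormalizer A) := by
    intro x hx
    induction hx using Submodule.span_induction with
    | mem x hx => exact Submodule.subset_span (star_mem_cstarNormalizer hx)
    | zero => rw [star_zero]; exact Submodule.zero_mem _
    | add x y _ _ hx hy => rw [star_add]; exact Submodule.add_mem _ hx hy
    | smul c x _ hx => rw [star_smul]; exact Submodule.smul_mem _ _ hx
  have hmul : ∀ x ∈ Submodule.span ℂ (cstarNormalizer A),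
      ∀ y ∈ Submodule.span ℂ (cstarNormalizer A),
        x * y ∈ Submodule.span ℂ (cstarNormalizer A) := by
    intro x hx y hy
    induction hx, hy using Submodule.span_induction₂ with
    | mem_mem x y hx hy => exact Submodule.subset_span (mul_mem_cstarNormalizer hx hy)
    | zero_left y _ => rw [zero_mul]; exact Submodule.zero_mem _
    | zero_right x _ => rw [mul_zero]; exact Submodule.zero_mem _
    | add_left x y z _ _ _ h1 h2 => rw [add_mul]; exact Submodule.add_mem _ h1 h2
    | add_right x y z _ _ _ h1 h2 => rw [mul_add]; exact Submodule.add_mem _ h1 h2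
    | smul_left r x y _ _ h1 => rw [smul_mul_assoc]; exact Submodule.smul_mem _ _ h1
    | smul_right r x y _ _ h1 => rw [mul_smul_comm]; exact Submodule.smul_mem _ _ h1
  induction hx using NonUnitalStarAlgebra.adjoin_induction with
  | mem x hx => exact Submodule.subset_span hx
  | add x y _ _ hx hy => exact Submodule.add_mem _ hx hy
  | zero => exact Submodule.zero_mem _
  | mul x y _ _ hx hy => exact hmul x hx y hy
  | smul r x _ hx => exact Submodule.smul_mem _ _ hx
  | star x _ hx => exact hstar x hx

theorem sum_mul_mem_adjoin {s : Set B} {κ : Type*} [Fintype κ] {v w : κ → B} (hv : ∀ k, v k ∈ s)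
    (hw : ∀ k, w k ∈ s) : ∑ k, v k * w k ∈ NonUnitalStarAlgebra.adjoin ℂ s :=
  sum_mem fun k _ => mul_mem (NonUnitalStarAlgebra.subset_adjoin ℂ _ (hv k))
    (NonUnitalStarAlgebra.subset_adjoin ℂ _ (hw k))

theorem containsApproximateUnit_of_unit {A : NonUnitalStarSubalgebra ℂ B} {e : B} (he : e ∈ A)
    (hl : ∀ b, e * b = b) (hr : ∀ b, b * e = b) (hn : ‖e‖ ≤ 1) : ContainsApproximateUnit A := by
  refine ⟨pure e, ⟨fun b => ?_, fun b => ?_⟩, he, hn, e, he, ?_⟩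
  · rw [Filter.tendsto_pure_left]
    intro s hs
    rw [hr]
    exact mem_of_mem_nhds hs
  · rw [Filter.tendsto_pure_left]
    intro s hs
    rw [hl]
    exact mem_of_mem_nhds hs
  · rw [← star_star (star e * e), star_mul, star_star, hr, star_star]

/-- The functionals `L i` play the role of evaluations of the expectation at the points `p i`; every
identity is checked there and holds throughout by density. -/
theorem exists_faithful_conditionalExpectation {X : Type*} [TopologicalSpace X] [CompactSpace X]
    (φ : C(X, ℂ) →⋆ₙₐ[ℂ] B) (hφ : Function.Injective φ) {I : Type*} {p : I → X} (hp : DenseRange p)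
    (L : I → B → ℂ) (hadd : ∀ i b c, L i (b + c) = L i b + L i c)
    (hsmul : ∀ i (r : ℂ) b, L i (r • b) = r * L i b) (hnorm : ∀ i b, ‖L i b‖ ≤ ‖b‖)
    (hfix : ∀ i a, L i (φ a) = a (p i)) (hleft : ∀ i a b, L i (φ a * b) = a (p i) * L i b)
    (hright : ∀ i a b, L i (b * φ a) = L i b * a (p i))
    (hpos : ∀ i b, ∃ r : ℝ, 0 ≤ r ∧ L i (star b * b) = r)
    (hfaithful : ∀ b, (∀ i, L i (star b * b) = 0) → b = 0)
    (hex : ∀ b, ∃ a : C(X, ℂ), ∀ i, L i b = a (p i)) :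
    ∃ P : B →ₗ[ℂ] B, IsConditionalExpectation (NonUnitalStarAlgHom.range φ) P ∧
      ∀ b, P (star b * b) = 0 → b = 0 := by
  choose D hD using hex
  have hDeq : ∀ b a, (∀ i, L i b = a (p i)) → D b = a := fun b a e =>
    ContinuousMap.eq_of_denseRange hp fun i => by rw [← hD, e]
  have hDleft : ∀ a b, D (φ a * b) = a * D b := fun a b =>
    hDeq _ _ fun i => by rw [hleft, hD, ContinuousMap.mul_apply]
  have hDright : ∀ a b, D (b * φ a) = D b * a := fun a b =>
    hDeq _ _ fun i => by rw [hright, hD, ContinuousMap.mul_apply]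
  have hmem : ∀ a, φ a ∈ NonUnitalStarAlgHom.range φ := fun a =>
    (NonUnitalStarAlgHom.mem_range φ).2 ⟨a, rfl⟩
  let P : B →ₗ[ℂ] B :=
    { toFun := fun b => φ (D b)
      map_add' := fun b c => by
        rw [← map_add]
        exact congrArg φ (hDeq _ _ fun i => by rw [hadd, hD, hD, ContinuousMap.add_apply])
      map_smul' := fun r b => by
        rw [RingHom.id_apply, ← map_smul]
        exact congrArg φ (hDeq _ _ fun i => by
          rw [hsmul, hD, ContinuousMap.smul_apply, smul_eq_mul]) }
  have hP : ∀ b, P b = φ (D b) := fun _ => rfl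
  refine ⟨P, ⟨fun b => hmem _, fun x hx => ?_, fun b => ?_, fun b => ?_, fun x hx b => ?_,
    fun x hx b => ?_⟩, fun b hb => ?_⟩
  · obtain ⟨a, rfl⟩ := (NonUnitalStarAlgHom.mem_range φ).1 hx
    rw [hP, hDeq _ a fun i => hfix i a]
  · rw [hP, NonUnitalStarAlgHom.norm_map φ hφ]
    exact ContinuousMap.norm_le_of_denseRange hp (norm_nonneg _) fun i => by
      rw [← hD]
      exact hnorm i b
  -- Positivity is known only at the points `p i`. With the absolute value the square root squares
  -- back at every point, and the absolute value drops out on the dense set.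
  · let c : C(X, ℂ) := ⟨fun z => ((√|(D (star b * b) z).re| : ℝ) : ℂ), by fun_prop⟩
    have hc : D (star b * b) = star c * c := by
      refine ContinuousMap.eq_of_denseRange hp fun i => ?_
      obtain ⟨r, hr, e⟩ := hpos i b
      have hx : (star c * c) (p i) = ((|(D (star b * b) (p i)).re| : ℝ) : ℂ) := by
        change (starRingEnd ℂ) ((√|(D (star b * b) (p i)).re| : ℝ) : ℂ) *
          ((√|(D (star b * b) (p i)).re| : ℝ) : ℂ) = _
        rw [Complex.conj_ofReal, ← Complex.ofReal_mul, Real.mul_self_sqrt (abs_nonneg _)]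
      rw [hx, ← hD, e, Complex.ofReal_re, abs_of_nonneg hr]
    exact ⟨φ c, hmem c, by rw [hP, hc, map_mul, map_star]⟩
  · obtain ⟨a, rfl⟩ := (NonUnitalStarAlgHom.mem_range φ).1 hx
    rw [hP, hP, hDleft, map_mul]
  · obtain ⟨a, rfl⟩ := (NonUnitalStarAlgHom.mem_range φ).1 hx
    rw [hP, hP, hDright, map_mul]
  · have h0 : D (star b * b) = 0 := hφ (by rw [← hP, hb, map_zero])
    exact hfaithful b fun i => by rw [hD, h0, ContinuousMap.zero_apply]

end Generation

namespace IFS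

/-! ### The Cartan conditions for `ρ̂_A(C(X))`, and regularity from graph separation -/

section Cartan

variable {X : Type*} [TopologicalSpace X] [CompactSpace X] {N : ℕ}
  {γ : Fin N → C(X, X)} {Y : Set X} (h : Admissible γ Y)

/-- The representation `ρ̂_A` as a homomorphism into `C*(ρ̂)`. -/
def rhoHatAHom : C(X, ℂ) →⋆ₙₐ[ℂ] cstarGenerated (rhoHatGenerators h) where
  toFun a := ⟨rhoHatA Y a, rhoHatA_mem h a⟩
  map_smul' c a := Subtype.ext ((rhoHatALinear Y).map_smul c a)
  map_zero' := Subtype.ext (rhoHatALinear Y).map_zero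
  map_add' a b := Subtype.ext ((rhoHatALinear Y).map_add a b)
  map_mul' a b := Subtype.ext (by
    change rhoHatA Y (a * b) = rhoHatA Y a * rhoHatA Y b
    rw [rhoHatA, rhoHatA, rhoHatA, Ell2.tensorShift_mul, rhoA_mul, add_zero])
  map_star' a := Subtype.ext (star_rhoHatA a).symm

theorem rhoHatA_one : rhoHatA Y (1 : C(X, ℂ)) = 1 := by
  refine Ell2.ext_basisHat fun v t => ?_
  rw [rhoHatA_basisHat]
  simp

theorem isometry_rhoHatAHom : Isometry (rhoHatAHom h) :=
  AddMonoidHomClass.isometry_of_norm (rhoHatAHom h) (norm_rhoHatA h)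

theorem mem_range_rhoHatAHom {b : cstarGenerated (rhoHatGenerators h)} :
    b ∈ NonUnitalStarAlgHom.range (rhoHatAHom h) ↔ ∃ a, rhoHatAHom h a = b :=
  NonUnitalStarAlgHom.mem_range _

theorem isCartanIn_dHat_iff [T2Space X] (hinj : JointlyInjective γ) (hfree : EssentiallyFree γ)
    (hclopen : ∀ n : ℕ, IsClopen ((image γ)^[n] univ)) :
    IsCartanIn (dHat h) (rhoHatGenerators h) ↔
      IsCartan (NonUnitalStarAlgHom.range (rhoHatAHom h)) := by
  have e : Subtype.val '' (NonUnitalStarAlgHom.range (rhoHatAHom h) :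
      Set (cstarGenerated (rhoHatGenerators h))) = (dHat h : Set (MatHat Y)) := by
    rw [dHat_eq h hinj hfree hclopen]
    ext x
    constructor
    · rintro ⟨y, hy, rfl⟩
      obtain ⟨a, rfl⟩ := (mem_range_rhoHatAHom h).1 hy
      exact ⟨a, rfl⟩
    · rintro ⟨a, rfl⟩
      exact ⟨rhoHatAHom h a, (mem_range_rhoHatAHom h).2 ⟨a, rfl⟩, rfl⟩
  refine ⟨fun ⟨A, hA, hC⟩ => ?_, fun hC => ⟨_, e, hC⟩⟩
  have : A = NonUnitalStarAlgHom.range (rhoHatAHom h) :=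
    SetLike.coe_injective (Subtype.val_injective.image_injective (hA.trans e.symm))
  rwa [← this]

theorem exists_function_of_finite [T2Space X] {F : Set X} (hF : F.Finite) {x : X} (hx : x ∉ F) :
    ∃ a : C(X, ℂ), a x = 1 ∧ (∀ z ∈ F, a z = 0) ∧ ‖a‖ ≤ 1 := by
  obtain ⟨f, hf0, hf1, hf⟩ := exists_continuous_zero_one_of_isClosed hF.isClosed
    (isClosed_singleton (x := x)) (disjoint_singleton_right.2 hx)
  refine ⟨⟨fun z => (f z : ℂ), Complex.continuous_ofReal.comp f.continuous⟩, ?_, fun z hz => ?_, ?_⟩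
  · simpa using hf1 rfl
  · simpa using hf0 hz
  · refine (ContinuousMap.norm_le _ zero_le_one).2 fun z => ?_
    simp only [ContinuousMap.coe_mk, Complex.norm_real, Real.norm_eq_abs]
    exact abs_le.2 ⟨by linarith [(hf z).1], (hf z).2⟩

/-- If `b` commutes with a function that is `1` at `u` and `0` at `v`, its entries at `(u, v)`
vanish in all degrees. So `b` is diagonal over `Y`, and freeness makes it a function. -/
theorem isMaximalAbelian_rhoHatA [T2Space X] (hinj : JointlyInjective γ) (hfree : EssentiallyFree γ)
    (hclopen : ∀ n : ℕ, IsClopen ((image γ)^[n] univ)) :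
    IsMaximalAbelian (NonUnitalStarAlgHom.range (rhoHatAHom h)) := by
  refine ⟨?_, fun A' _ hcomm hle => hle.antisymm' fun b hb => ?_⟩
  · intro x hx y hy
    obtain ⟨a, rfl⟩ := (mem_range_rhoHatAHom h).1 hx
    obtain ⟨c, rfl⟩ := (mem_range_rhoHatAHom h).1 hy
    rw [← map_mul, ← map_mul, mul_comm]
  · obtain ⟨a, ha⟩ := eq_rhoHatA_of_blockDiagonal hfree hclopen (cstarGenerated_subset h hinj b.2)
      fun u s v t huv => by
        obtain ⟨a, hu, hv, -⟩ := exists_function_of_finite (finite_singleton v.1)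
          (x := u.1) fun e => huv (Subtype.ext e)
        have e := congrArg Subtype.val
          (hcomm _ (hle ((mem_range_rhoHatAHom h).2 ⟨a, rfl⟩)) b hb)
        have e' := congrArg (Ell2.entry u s v t) e
        change Ell2.entry u s v t (rhoHatA Y a * b.1) =
          Ell2.entry u s v t (b.1 * rhoHatA Y a) at e'
        rwa [entry_rhoHatA_mul, entry_mul_rhoHatA, hu, hv _ rfl, one_mul, mul_zero] at e'
    exact (mem_range_rhoHatAHom h).2 ⟨a, Subtype.ext ha.symm⟩

/-- Faithfulness: the diagonal entries of `b* b` are the squared norms of the columns of `b`. -/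
theorem exists_expectation_rhoHatA [T2Space X] (hinj : JointlyInjective γ)
    (hclopen : ∀ n : ℕ, IsClopen ((image γ)^[n] univ)) :
    ∃ P : cstarGenerated (rhoHatGenerators h) →ₗ[ℂ] cstarGenerated (rhoHatGenerators h),
      IsConditionalExpectation (NonUnitalStarAlgHom.range (rhoHatAHom h)) P ∧
        ∀ b, P (star b * b) = 0 → b = 0 := by
  refine exists_faithful_conditionalExpectation (rhoHatAHom h) (isometry_rhoHatAHom h).injective
    (p := fun i : Y × ℤ => i.1.1) ?_ (fun i b => Ell2.entry i.1 i.2 i.1 i.2 b.1)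
    (fun i b c => map_add (Ell2.entry i.1 i.2 i.1 i.2) b.1 c.1)
    (fun i r b => map_smul (Ell2.entry i.1 i.2 i.1 i.2) r b.1)
    (fun i b => Ell2.norm_entry_le _ _ _ _ b.1)
    (fun i a => entry_rhoHatA_self a i.1 i.2) (fun i a b => entry_rhoHatA_mul a b.1 _ _ _ _)
    (fun i a b => entry_mul_rhoHatA a b.1 _ _ _ _)
    (fun i b => ⟨_, sq_nonneg _, Ell2.entry_star_mul_self b.1 i.1 i.2⟩) (fun b hb => ?_) (fun b => ?_)
  · have hs : Function.Surjective (Prod.fst : Y × ℤ → Y) := Prod.fst_surjective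
    change Dense (range (Subtype.val ∘ Prod.fst))
    rw [hs.range_comp]
    exact h.dense.denseRange_val
  · refine Subtype.ext (Ell2.ext_basisHat fun x s => ?_)
    have hx := (Ell2.entry_star_mul_self b.1 x s).symm.trans (hb (x, s))
    rw [Complex.ofReal_eq_zero] at hx
    exact norm_eq_zero.1 (pow_eq_zero_iff two_ne_zero |>.1 hx)
  · obtain ⟨a, ha⟩ := exists_extension_diagonal hclopen (cstarGenerated_subset h hinj b.2)
    exact ⟨a, fun i => ha i.1 i.2⟩

theorem rhoE_one : rhoE h (1 : C(graph γ, ℂ)) = branchOp h := by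
  rw [rhoE, branchOp]
  refine Finset.sum_congr rfl fun k _ => ?_
  change letterIsometry h k * rhoA Y 1 = _
  rw [rhoA_one, mul_one]

/-- Joint injectivity turns graph separation into disjointness of the ranges: a common value would
have equal preimages. Each range is then `γ(X)` minus finitely many compact sets. -/
theorem isClopen_range_of_graphSeparation [T2Space X] (hinj : JointlyInjective γ)
    (hsep : GraphSeparation γ) (hclopen : IsClopen (image γ univ)) (k : Fin N) :
    IsClopen (range (γ k)) := by
  have hcl : ∀ j, IsClosed (range (γ j)) := fun j => (isCompact_range (γ j).continuous).isClosed
  refine ⟨hcl k, ?_⟩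
  have e : range (γ k) = image γ univ ∩ (⋃ j ∈ {j | j ≠ k}, range (γ j))ᶜ := by
    ext u
    simp only [mem_inter_iff, mem_compl_iff, mem_iUnion, mem_image_iff, mem_range, mem_univ,
      true_and, mem_ofPred_eq, not_exists]
    constructor
    · rintro ⟨x, rfl⟩
      refine ⟨⟨k, x, rfl⟩, fun j hj y e => hsep j k hj y ?_⟩
      rw [e, hinj j k y x e]
    · rintro ⟨⟨j, x, rfl⟩, hu⟩
      by_cases hj : j = k
      · exact ⟨x, by rw [hj]⟩
      · exact absurd rfl (hu j hj x)
  rw [e]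
  exact hclopen.isOpen.inter
    ((toFinite _).isClosed_biUnion fun j _ => hcl j).isOpen_compl

theorem letterIsometry_mul_star (k : Fin N) (hk : IsClopen (range (γ k))) :
    letterIsometry h k * star (letterIsometry h k) = rhoA Y (clopenIndicator hk) := by
  refine Ell2.ext_basis fun u => ?_
  change letterIsometry h k (star (letterIsometry h k) (Ell2.basis u)) = _
  rw [rhoA_basis]
  by_cases hu : u.1 ∈ range (γ k)
  · obtain ⟨x, hx⟩ := hu
    have hxY : x ∈ Y := (h.invariant k).2 (by rw [mem_preimage, hx]; exact u.2)
    obtain rfl : u = h.letter k ⟨x, hxY⟩ := Subtype.ext hx.symm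
    rw [star_letterIsometry_basis_self, letterIsometry_basis]
    have e : clopenIndicator hk (h.letter k ⟨x, hxY⟩) = 1 :=
      indicator_of_mem (show γ k x ∈ range (γ k) from ⟨x, rfl⟩) fun _ => (1 : ℂ)
    rw [e, one_smul]
  · rw [star_letterIsometry_basis_of_forall_ne h fun x e => hu ⟨x, congrArg Subtype.val e⟩, map_zero]
    have e : clopenIndicator hk u.1 = 0 := indicator_of_notMem hu fun _ => (1 : ℂ)
    rw [e, zero_smul]

theorem rhoA_mul_branchOp [T2Space X] (hinj : JointlyInjective γ)
    (hsep : GraphSeparation γ) (k : Fin N) (hk : IsClopen (range (γ k))) :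
    rhoA Y (clopenIndicator hk) * branchOp h = letterIsometry h k := by
  refine Ell2.ext_basis fun x => ?_
  change rhoA Y (clopenIndicator hk) (branchOp h (Ell2.basis x)) = _
  rw [branchOp_basis, map_sum, letterIsometry_basis, Finset.sum_eq_single k]
  · have e : clopenIndicator hk (h.letter k x) = 1 :=
      indicator_of_mem (show γ k x ∈ range (γ k) from ⟨x, rfl⟩) fun _ => (1 : ℂ)
    rw [rhoA_basis, e, one_smul]
  · intro j _ hj
    have hjx : γ j x ∉ range (γ k) := by
      rintro ⟨y, e⟩
      refine hsep j k hj x ?_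
      rw [← e, hinj k j y x e]
    have e : clopenIndicator hk (h.letter j x) = 0 := indicator_of_notMem hjx fun _ => (1 : ℂ)
    rw [rhoA_basis, e, zero_smul]
  · simp

theorem star_letterIsometry_mul_rhoA_mul (k : Fin N) (a : C(X, ℂ)) :
    star (letterIsometry h k) * rhoA Y a * letterIsometry h k = rhoA Y (a.comp (γ k)) := by
  refine Ell2.ext_basis fun x => ?_
  change star (letterIsometry h k) (rhoA Y a (letterIsometry h k (Ell2.basis x))) = _
  rw [letterIsometry_basis, rhoA_basis, map_smul, star_letterIsometry_basis_self, rhoA_basis]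
  rfl

/-- The isometry of a letter is the indicator of its range times `T`, hence lies in C*(ρ̂) after
tensoring with `υ_1`. Conjugation by it carries functions to functions in both directions, and
`ρ̂_E(f)` is a sum of such isometries times functions. -/
theorem isRegular_rhoHatA [T2Space X] (hinj : JointlyInjective γ) (hsep : GraphSeparation γ)
    (hclopen : IsClopen (image γ univ)) :
    IsRegularSubalgebra (NonUnitalStarAlgHom.range (rhoHatAHom h)) := by
  have hk := isClopen_range_of_graphSeparation hinj hsep hclopen
  have hmem : ∀ k, Ell2.tensorShift 1 (letterIsometry h k) ∈
      cstarGenerated (rhoHatGenerators h) := fun k => by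
    have e : Ell2.tensorShift 1 (letterIsometry h k) =
        rhoHatA Y (clopenIndicator (hk k)) * rhoHatE h 1 := by
      rw [rhoHatA, rhoHatE, Ell2.tensorShift_mul, rhoE_one, rhoA_mul_branchOp h hinj hsep, zero_add]
    rw [e]
    exact mul_mem (rhoHatA_mem h _) (rhoHatE_mem h _)
  have hnormA : ∀ a, rhoHatAHom h a ∈
      cstarNormalizer (NonUnitalStarAlgHom.range (rhoHatAHom h)) := fun a x hx => by
    have ha : rhoHatAHom h a ∈ NonUnitalStarAlgHom.range (rhoHatAHom h) :=
      (mem_range_rhoHatAHom h).2 ⟨a, rfl⟩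
    exact ⟨mul_mem (mul_mem ha hx) (star_mem ha), mul_mem (mul_mem (star_mem ha) hx) ha⟩
  have hnormV : ∀ k, (⟨_, hmem k⟩ : cstarGenerated (rhoHatGenerators h)) ∈
      cstarNormalizer (NonUnitalStarAlgHom.range (rhoHatAHom h)) := fun k x hx => by
    obtain ⟨a, rfl⟩ := (mem_range_rhoHatAHom h).1 hx
    obtain ⟨c, hc⟩ := exists_lift_function hinj a
    constructor
    · refine (mem_range_rhoHatAHom h).2 ⟨c * clopenIndicator (hk k), Subtype.ext ?_⟩
      change rhoHatA Y _ = Ell2.tensorShift 1 (letterIsometry h k) * rhoHatA Y a *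
        star (Ell2.tensorShift 1 (letterIsometry h k))
      rw [Ell2.star_tensorShift, rhoHatA, rhoHatA, Ell2.tensorShift_mul, Ell2.tensorShift_mul,
        letterIsometry_mul_rhoA h (hc k), mul_assoc, letterIsometry_mul_star h k (hk k), rhoA_mul]
      rfl
    · refine (mem_range_rhoHatAHom h).2 ⟨a.comp (γ k), Subtype.ext ?_⟩
      change rhoHatA Y _ = star (Ell2.tensorShift 1 (letterIsometry h k)) * rhoHatA Y a *
        Ell2.tensorShift 1 (letterIsometry h k)
      rw [Ell2.star_tensorShift, rhoHatA, rhoHatA, Ell2.tensorShift_mul, Ell2.tensorShift_mul,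
        star_letterIsometry_mul_rhoA_mul]
      rfl
  refine eq_top_of_generators_mem (NonUnitalStarSubalgebra.isClosed_topologicalClosure _) ?_
  rintro _ (⟨a, rfl⟩ | ⟨f, rfl⟩)
  · exact subset_closure (NonUnitalStarAlgebra.subset_adjoin ℂ _ (hnormA a))
  · refine subset_closure ?_
    have e : (⟨rhoHatE h f, subset_cstarGenerated _ (Or.inr ⟨f, rfl⟩)⟩ :
        cstarGenerated (rhoHatGenerators h)) =
        ∑ k, ⟨_, hmem k⟩ * rhoHatAHom h (f.comp (graphMap γ k)) := by
      refine Subtype.ext ?_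
      rw [AddSubmonoidClass.coe_finsetSum]
      change Ell2.tensorShift 1 (∑ k, letterIsometry h k * rhoA Y (f.comp (graphMap γ k))) = _
      rw [map_sum]
      refine Finset.sum_congr rfl fun k _ => ?_
      change _ = Ell2.tensorShift 1 (letterIsometry h k) * rhoHatA Y (f.comp (graphMap γ k))
      rw [rhoHatA, Ell2.tensorShift_mul, add_zero]
    rw [e]
    exact sum_mul_mem_adjoin hnormV fun k => hnormA _

theorem isCartan_of_graphSeparation [T2Space X] (hinj : JointlyInjective γ)
    (hfree : EssentiallyFree γ) (hclopen : ∀ n : ℕ, IsClopen ((image γ)^[n] univ))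
    (hsep : GraphSeparation γ) : IsCartan (NonUnitalStarAlgHom.range (rhoHatAHom h)) where
  isClosed := (isometry_rhoHatAHom h).isClosedEmbedding.isClosed_range
  approximateUnit := by
    have h1 : ∀ b, rhoHatAHom h 1 * b = b := fun b => Subtype.ext (by
      change rhoHatA Y 1 * b.1 = b.1
      rw [rhoHatA_one, one_mul])
    have h2 : ∀ b, b * rhoHatAHom h 1 = b := fun b => Subtype.ext (by
      change b.1 * rhoHatA Y 1 = b.1
      rw [rhoHatA_one, mul_one])
    exact containsApproximateUnit_of_unit ((mem_range_rhoHatAHom h).2 ⟨1, rfl⟩) h1 h2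
      ((norm_rhoHatA_le _).trans ((ContinuousMap.norm_le _ zero_le_one).2 fun x => by simp))
  maximalAbelian := isMaximalAbelian_rhoHatA h hinj hfree hclopen
  regular := isRegular_rhoHatA h hinj hsep (hclopen 1)
  expectation := exists_expectation_rhoHatA h hinj hclopen

end Cartan

end IFS

namespace Ell2

theorem tensorShift_zero_apply {G : Type*} [NormedAddCommGroup G] [InnerProductSpace ℂ G]
    [CompleteSpace G] (α : G →L[ℂ] G) (v : Ell2 ℤ G) (l : ℤ) : tensorShift 0 α v l = α (v l) := by
  have e : tensorShift 0 α = ampl α := ext_incl fun t w => by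
    rw [tensorShift_incl, ampl_incl, zero_add]
  rw [e]
  rfl

theorem summable_norm_mul_norm {ι : Type*} {G : Type*} [NormedAddCommGroup G] (v w : Ell2 ι G) :
    Summable fun i => ‖v i‖ * ‖w i‖ := by
  refine lp.summable_mul ?_ v w
  rw [ENNReal.toReal_ofNat]
  exact Real.HolderConjugate.two_two

end Ell2

namespace IFS

/-! ### Entries at the positions `(γ_j(x), x)` and their degrees -/

section Degrees

variable {X : Type*} [TopologicalSpace X] {N : ℕ} {γ : Fin N → C(X, X)} {Y : Set X}
  {h : Admissible γ Y}

theorem wordMap_injective (hinj : JointlyInjective γ) {n : ℕ} (k : Fin n → Fin N) :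
    Function.Injective (wordMap γ k) := by
  induction n with
  | zero => exact fun x y e => e
  | succ n ih =>
    intro x y e
    rw [wordMap_succ, wordMap_succ] at e
    exact ih _ (hinj _ _ _ _ e)

theorem overlap_letter (q : ℕ) (i : Fin N) (x : Y) :
    overlap h (q + 1) q (h.letter i x) x = overlap h q q x x := by
  rw [overlap, pow_succ]
  change inner ℂ ((star (branchOp h) ^ q) (star (branchOp h) _)) _ = _
  rw [star_branchOp_basis_letter]
  rfl

theorem denseRange_graphMap (h : Admissible γ Y) :
    DenseRange fun i : Fin N × Y => graphMap γ i.1 i.2.1 := by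
  rintro ⟨⟨u, y⟩, k, hk⟩
  obtain rfl : u = γ k y := hk
  have hy := h.dense.denseRange_val y
  have := mem_closure_image (graphMap γ k).continuous.continuousAt hy
  refine closure_mono ?_ this
  rintro _ ⟨_, ⟨x, rfl⟩, rfl⟩
  exact ⟨(k, x), rfl⟩

/-- Outside the exceptional set the pair `(γ_j(x), x)` arises from a common point only by words
whose lengths differ by one, so only degree one is possible. -/
theorem entry_letter_eq_zero {b : MatHat Y} (hb : b ∈ gradedSpace h) {j : Fin N} {x : Y}
    (hx : ¬∃ (p q : ℕ) (w : Fin p → Fin N) (v : Fin q → Fin N) (z : X),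
      p ≠ q + 1 ∧ x.1 = wordMap γ v z ∧ γ j x = wordMap γ w z) {s t : ℤ} (hst : s - t ≠ 1) :
    Ell2.entry (h.letter j x) s x t b = 0 := by
  by_contra hne
  obtain ⟨p, q, hpq, ho⟩ := exists_overlap_ne_zero_of_entry_ne_zero hb hne
  obtain ⟨w, v, z, hw, hv⟩ := exists_word_of_overlap_ne_zero h ho
  exact hx ⟨p, q, w, v, z, by omega, congrArg Subtype.val hv, congrArg Subtype.val hw⟩

end Degrees

/-! ### Regularity forces graph separation -/

section Converse

variable {X : Type*} [TopologicalSpace X] [CompactSpace X] {N : ℕ}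
  {γ : Fin N → C(X, X)} {Y : Set X} {h : Admissible γ Y}

/-- Extending over the graph, and not over `X` for each letter separately, is essential: where two
branches meet, their entries must have the same limit. -/
theorem exists_extension_graph (hclopen : ∀ n : ℕ, IsClopen ((image γ)^[n] univ)) {b : MatHat Y}
    (hb : b ∈ gradedSpace h) : ∃ a : C(graph γ, ℂ), ∀ (i : Fin N) (x : Y) (s t : ℤ), s - t = 1 →
      Ell2.entry (h.letter i x) s x t b = a (graphMap γ i x) := by
  obtain ⟨a, ha⟩ := exists_extension_of_mem_gradedSpace hb (denseRange_graphMap h)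
    (fun i => h.letter i.1 i.2) (fun i => i.2)
    ⟨fun z => z.1.1, continuous_fst.comp continuous_subtype_val⟩
    ⟨fun z => z.1.2, continuous_snd.comp continuous_subtype_val⟩
    (fun _ => rfl) (fun _ => rfl) 1 fun p q hpq => by
      obtain rfl : p = q + 1 := by omega
      exact ⟨(clopenIndicator (hclopen q)).comp
        ⟨fun z => z.1.2, continuous_snd.comp continuous_subtype_val⟩, fun i =>
          (overlap_letter q i.1 i.2).trans (overlap_self_eq h hclopen q i.2)⟩
  exact ⟨a, fun i x s t hst => ha (i, x) s t hst⟩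

variable [T2Space X]

open Filter in
-- Contractive functions that equal `1` at `x` and vanish on growing finite sets of other points
-- converge weakly to the projection onto `e_x ⊗ ℓ²(ℤ)`. Dominated convergence is applied first over
-- `Y` and then over `ℤ`.
theorem tsum_eq_zero_of_forall_inner_rhoHatA {ξ η : Ell2 ℤ (Ell2 Y ℂ)}
    (e : ∀ a, inner ℂ ξ (rhoHatA Y a η) = 0) (x : Y) :
    ∑' l, star (ξ l x) * η l x = 0 := by
  classical
  have hex : ∀ F : Finset Y, ∃ a : C(X, ℂ), a x = 1 ∧ (∀ z ∈ F, z ≠ x → a z = 0) ∧ ‖a‖ ≤ 1 := by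
    intro F
    obtain ⟨a, h1, h0, hn⟩ := exists_function_of_finite
      (((F.erase x).finite_toSet).image Subtype.val) (x := x.1) (by
        rintro ⟨z, hz, e⟩
        exact (Finset.mem_erase.1 hz).1 (Subtype.ext e))
    exact ⟨a, h1, fun z hz hzx => h0 _ ⟨z, Finset.mem_erase.2 ⟨hzx, hz⟩, rfl⟩, hn⟩
  choose a ha1 ha0 han using hex
  have hinner : ∀ v w : Ell2 Y ℂ,
      Tendsto (fun F => inner ℂ v (rhoA Y (a F) w)) atTop (𝓝 (star (v x) * w x)) := by
    intro v w
    have hlim : star (v x) * w x = ∑' z : Y, if z = x then star (v x) * w x else 0 := by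
      rw [tsum_ite_eq]
    rw [hlim]
    simp only [lp.inner_eq_tsum]
    refine tendsto_tsum_of_dominated_convergence (Ell2.summable_norm_mul_norm v w) (fun z => ?_)
      (Eventually.of_forall fun F z => ?_)
    · refine tendsto_const_nhds.congr' ?_
      filter_upwards [eventually_ge_atTop {z}] with F hF
      have e1 : rhoA Y (a F) w z = a F z * w z := rfl
      rw [e1]
      split_ifs with hz
      · rw [hz, ha1, one_mul, RCLike.inner_apply, mul_comm]
        rfl
      · rw [ha0 F z (hF (Finset.mem_singleton_self z)) hz, zero_mul, inner_zero_right]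
    · have e1 : rhoA Y (a F) w z = a F z * w z := rfl
      rw [e1]
      refine (norm_inner_le_norm _ _).trans ?_
      rw [norm_mul]
      have := ((a F).norm_coe_le_norm z).trans (han F)
      gcongr
      exact mul_le_of_le_one_left (norm_nonneg _) this
  have hsum : Tendsto (fun F => inner ℂ ξ (rhoHatA Y (a F) η)) atTop
      (𝓝 (∑' l, star (ξ l x) * η l x)) := by
    simp only [lp.inner_eq_tsum]
    refine tendsto_tsum_of_dominated_convergence (Ell2.summable_norm_mul_norm ξ η) (fun l => ?_)
      (Eventually.of_forall fun F l => ?_)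
    · simp only [rhoHatA, Ell2.tensorShift_zero_apply]
      simpa only [lp.inner_eq_tsum] using hinner (ξ l) (η l)
    · rw [rhoHatA, Ell2.tensorShift_zero_apply]
      refine (norm_inner_le_norm (𝕜 := ℂ) (ξ l) (rhoA Y (a F) (η l))).trans ?_
      gcongr
      calc ‖rhoA Y (a F) (η l)‖ ≤ ‖rhoA Y (a F)‖ * ‖η l‖ := ContinuousLinearMap.le_opNorm _ _
        _ ≤ 1 * ‖η l‖ := by
          gcongr
          exact (Ell2.norm_diagonal_le _ _).trans (han F)
        _ = ‖η l‖ := one_mul _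
  simp only [e] at hsum
  exact (tendsto_nhds_unique hsum tendsto_const_nhds)

/-- The set is a countable union, over pairs of words, of images under `γ_v` of the coincidence sets
of `jv` and `w`. These words differ because their lengths do. -/
theorem isMeagre_degree_exceptional (hinj : JointlyInjective γ) (hfree : EssentiallyFree γ)
    (j : Fin N) : IsMeagre {x : X | ∃ (p q : ℕ) (w : Fin p → Fin N) (v : Fin q → Fin N) (z : X),
      p ≠ q + 1 ∧ x = wordMap γ v z ∧ γ j x = wordMap γ w z} := by
  let I := {c : ((n : ℕ) × (Fin n → Fin N)) × ((n : ℕ) × (Fin n → Fin N)) // c.1.1 ≠ c.2.1 + 1}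
  have hm : IsMeagre (⋃ c : I, wordMap γ c.1.2.2 ''
      {z | wordMap γ (Fin.snoc c.1.2.2 j : Fin (c.1.2.1 + 1) → Fin N) z =
        wordMap γ c.1.1.2 z}) := by
    refine isMeagre_iUnion fun c => IsNowhereDense.isMeagre ?_
    have hne : (⟨c.1.2.1 + 1, Fin.snoc c.1.2.2 j⟩ : (n : ℕ) × (Fin n → Fin N)) ≠ c.1.1 := by
      intro e
      exact c.2 (congrArg Sigma.fst e).symm
    have hnd := hfree _ _ hne
    have hcl : IsClosed {z | wordMap γ (Fin.snoc c.1.2.2 j : Fin (c.1.2.1 + 1) → Fin N) z =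
        wordMap γ c.1.1.2 z} := isClosed_eq (continuous_wordMap _) (continuous_wordMap _)
    have hint := hnd
    rw [IsNowhereDense, hcl.closure_eq] at hint
    have hcl' := ((hcl.isCompact).image (continuous_wordMap (γ := γ) c.1.2.2)).isClosed
    rw [IsNowhereDense, hcl'.closure_eq, eq_empty_iff_forall_notMem]
    intro x hx
    obtain ⟨z, -, rfl⟩ := interior_subset hx
    -- An open set inside the image would pull back along the injective map `γ_v` to an open subset
    -- of the coincidence set.
    have hz : z ∈ interior {z | wordMap γ (Fin.snoc c.1.2.2 j : Fin (c.1.2.1 + 1) → Fin N) z =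
        wordMap γ c.1.1.2 z} := by
      refine mem_interior.2 ⟨wordMap γ c.1.2.2 ⁻¹' interior _, fun y hy => ?_,
        isOpen_interior.preimage (continuous_wordMap _), hx⟩
      obtain ⟨y', hy', e⟩ := interior_subset hy
      rwa [← wordMap_injective hinj c.1.2.2 e]
    rw [hint] at hz
    exact hz
  refine hm.mono ?_
  rintro x ⟨p, q, w, v, z, hpq, rfl, e⟩
  exact mem_iUnion.2 ⟨⟨(⟨p, w⟩, ⟨q, v⟩), hpq⟩, z, (wordMap_snoc v j z).trans e, rfl⟩

/-- The entry of `b c b*` at `(γ_j(x), γ_k(x))` vanishes for every `c`; localizing `c` at `x` leaves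
a sum over degrees. It suffices that `x` is not exceptional for `j`, since that already kills the
first factor of every term but one. -/
theorem entry_mul_star_entry_eq_zero {b : MatHat Y} (hb : b ∈ gradedSpace h)
    (hnorm : ∀ a, ∃ c, b * rhoHatA Y a * star b = rhoHatA Y c) {j k : Fin N} (hjk : j ≠ k) {x : Y}
    (hx : ¬∃ (p q : ℕ) (w : Fin p → Fin N) (v : Fin q → Fin N) (z : X),
      p ≠ q + 1 ∧ x.1 = wordMap γ v z ∧ γ j x = wordMap γ w z) :
    Ell2.entry (h.letter j x) 1 x 0 b * star (Ell2.entry (h.letter k x) 1 x 0 b) = 0 := by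
  have hsum := tsum_eq_zero_of_forall_inner_rhoHatA
    (ξ := star b (Ell2.basisHat (h.letter j x) 1)) (η := star b (Ell2.basisHat (h.letter k x) 1))
    (fun a => by
      obtain ⟨c, hc⟩ := hnorm a
      have e := entry_rhoHatA_of_ne c (u := h.letter j x) (v := h.letter k x)
        (fun e => hjk (h.letter_eq_iff.1 e).1) 1 1
      rw [← hc] at e
      rw [ContinuousLinearMap.star_eq_adjoint, ContinuousLinearMap.adjoint_inner_left]
      exact e) x
  have hcoef : ∀ (i : Fin N) (l : ℤ), star b (Ell2.basisHat (h.letter i x) 1) l x =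
      star (Ell2.entry (h.letter i x) 1 x l b) := fun i l => by
    rw [← Ell2.inner_basisHat_left, ← Ell2.entry_star]
    rfl
  simp only [hcoef, star_star] at hsum
  rwa [tsum_eq_single 0] at hsum
  intro l hl
  rw [entry_letter_eq_zero hb hx (by omega), zero_mul]

theorem graphSeparation_of_isRegular (hinj : JointlyInjective γ) (hY : Y ∈ residual X)
    (hfree : EssentiallyFree γ) (hclopen : ∀ n : ℕ, IsClopen ((image γ)^[n] univ))
    (hreg : IsRegularSubalgebra (NonUnitalStarAlgHom.range (rhoHatAHom h))) :
    GraphSeparation γ := by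
  intro j k hjk x₀ hx₀
  let z₀ : graph γ := graphMap γ j x₀
  have hz₀ : graphMap γ k x₀ = z₀ := Subtype.ext (Prod.ext hx₀.symm rfl)
  -- Vanishing at the point where the branches `j` and `k` meet is a closed linear condition, which
  -- normalizers satisfy and `ρ̂_E(1)` does not.
  let W : Submodule ℂ C(graph γ, ℂ) :=
    { carrier := {a | a z₀ = 0}
      zero_mem' := rfl
      add_mem' := fun {a c} ha hc => by
        change a z₀ + c z₀ = 0
        rw [show a z₀ = 0 from ha, show c z₀ = 0 from hc, add_zero]
      smul_mem' := fun r a ha => by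
        change r * a z₀ = 0
        rw [show a z₀ = 0 from ha, mul_zero] }
  have hW : IsClosed (W : Set C(graph γ, ℂ)) :=
    isClosed_eq (continuous_eval_const z₀) continuous_const
  let Q : Submodule ℂ (MatHat Y) := extensionSpace (fun i : Fin N × Y => graphMap γ i.1 i.2.1)
    (fun i => Ell2.entry (h.letter i.1 i.2) 1 i.2 0) W
  have hQ : IsClosed (Q : Set (MatHat Y)) := isClosed_extensionSpace (denseRange_graphMap h)
    (fun i b => Ell2.norm_entry_le _ _ _ _ b) hW
  have hnorm : ∀ b ∈ cstarNormalizer (NonUnitalStarAlgHom.range (rhoHatAHom h)), b.1 ∈ Q := by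
    intro b hb
    have hbG := cstarGenerated_subset h hinj b.2
    obtain ⟨a, ha⟩ := exists_extension_graph hclopen hbG
    refine ⟨a, ?_, fun i => ha i.1 i.2 1 0 (by norm_num)⟩
    -- Baire: a comeager set minus a meagre one is dense in the compact Hausdorff space `X`.
    have hdense : Dense (Y ∩ {x : X | ∃ (p q : ℕ) (w : Fin p → Fin N) (v : Fin q → Fin N) (z : X),
        p ≠ q + 1 ∧ x = wordMap γ v z ∧ γ j x = wordMap γ w z}ᶜ) :=
      dense_of_mem_residual (Filter.inter_mem hY (isMeagre_degree_exceptional hinj hfree j))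
    have hzero : (a.comp (graphMap γ j)) * star (a.comp (graphMap γ k)) = 0 := by
      refine ContinuousMap.eq_of_denseRange hdense.denseRange_val fun x => ?_
      have e := entry_mul_star_entry_eq_zero hbG (fun a => by
        obtain ⟨c, hc⟩ := (mem_range_rhoHatAHom h).1
          (hb _ ((mem_range_rhoHatAHom h).2 ⟨a, rfl⟩)).1
        exact ⟨c, (congrArg Subtype.val hc).symm⟩) hjk (x := ⟨x.1, x.2.1⟩) x.2.2
      rw [ha _ _ _ _ (by norm_num), ha _ _ _ _ (by norm_num)] at e
      exact e
    -- At `x₀` the two factors are `a z₀` and its conjugate.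
    have e := DFunLike.congr_fun hzero x₀
    change a z₀ * star (a (graphMap γ k x₀)) = 0 at e
    rw [hz₀] at e
    rcases mul_eq_zero.1 e with e | e
    · exact e
    · exact star_eq_zero.1 e
  have hadj : (NonUnitalStarAlgebra.adjoin ℂ
      (cstarNormalizer (NonUnitalStarAlgHom.range (rhoHatAHom h))) :
        Set (cstarGenerated (rhoHatGenerators h))) ⊆ Subtype.val ⁻¹' (Q : Set (MatHat Y)) := by
    intro x hx
    replace hx := adjoin_cstarNormalizer_subset_span hx
    induction hx using Submodule.span_induction with
    | mem x hx => exact hnorm x hx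
    | zero => exact Q.zero_mem
    | add x y _ _ hx hy => exact Q.add_mem hx hy
    | smul c x _ hx => exact Q.smul_mem c hx
  have hall : ∀ x : cstarGenerated (rhoHatGenerators h), x.1 ∈ Q := fun x => by
    have hx : x ∈ (NonUnitalStarAlgebra.adjoin ℂ
        (cstarNormalizer (NonUnitalStarAlgHom.range (rhoHatAHom h)))).topologicalClosure := by
      rw [show _ = ⊤ from hreg]
      trivial
    exact closure_minimal hadj (hQ.preimage continuous_subtype_val) hx
  obtain ⟨a, haW, ha⟩ := hall ⟨rhoHatE h 1, rhoHatE_mem h 1⟩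
  have ha1 : a = 1 := by
    refine ContinuousMap.eq_of_denseRange (denseRange_graphMap h) fun i => ?_
    rw [← ha i]
    change Ell2.entry (h.letter i.1 i.2) 1 i.2 0 (Ell2.tensorShift 1 (rhoE h 1)) = 1
    rw [Ell2.entry_tensorShift, if_pos (by norm_num), rhoE_one, branchOp_basis, inner_sum,
      Finset.sum_eq_single i.1]
    · exact Ell2.inner_basis_self _
    · intro l _ hl
      exact Ell2.inner_basis_of_ne fun e => hl (h.letter_eq_iff.1 e).1.symm
    · simp
  rw [ha1] at haW
  exact one_ne_zero (show (1 : ℂ) = 0 from haW)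

end Converse

end IFS

end

theorem theorem5p10p2 {X : Type*} [TopologicalSpace X] [CompactSpace X] [T2Space X]
    [FirstCountableTopology X] {N : ℕ} (γ : Fin N → C(X, X)) (Y U : Set X)
    (h : IFS.Admissible γ Y)
    (hemb : ∀ k, Topology.IsEmbedding (γ k))
    (hU : IFS.OpenSetCondition γ U)
    (hYU : Y ⊆ U)
    (hY : Y ∈ residual X)
    (hfree : IFS.EssentiallyFree γ)
    (hclopen : ∀ n : ℕ, IsClopen ((IFS.image γ)^[n] Set.univ))
    (hσ : ∃ σ : C(IFS.image γ Set.univ, X), ∀ (k : Fin N) (x : X)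
      (hx : γ k x ∈ IFS.image γ Set.univ), σ ⟨γ k x, hx⟩ = x) :
    IFS.GraphSeparation γ ↔ IsCartanIn (IFS.dHat h) (IFS.rhoHatGenerators h) := by
  have hinj := IFS.jointlyInjective_of_leftInverse hσ
  rw [IFS.isCartanIn_dHat_iff h hinj hfree hclopen]
  -- The converse needs only regularity from the Cartan conditions.
  exact ⟨IFS.isCartan_of_graphSeparation h hinj hfree hclopen, fun hC =>
    IFS.graphSeparation_of_isRegular hinj hY hfree hclopen hC.regular⟩
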